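/- Let $f$ be an analytic function with values in $\mathbb C^2$ on a domain $\mathcal D\subset\mathbb C\times\mathbb C^2\times\mathbb C$, taking real values at real arguments, and let $\varphi:\mathcal D_t\to\mathbb C^2$ be analytic on a domain $\mathcal D_t\subset\mathbb C$ with $(t,\varphi(t),0)\in\mathcal D$ and $f(t,\varphi(t),0)=0$ (the slow curve), where $\mathcal D_t\cap\mathbb R=\,]t_m,t_M[$ with $-\infty\le t_m<t_M\le+\infty$. Let $t_m<a<b<t_M$, and for real $t\in\,]t_m,t_M[$ let $\lambda(t),\mu(t)$ be the eigenvalues (with multiplicity) of $D_Xf(t,\varphi(t),0)$. Suppose that $\Re\lambda,\Re\mu$ are both negative for $t<a$, zero at $t=a$ and positive for $t>a$; that $\Im\lambda(t)<0<\Im\mu(t)$ for $t<b$; and that $\lambda,\mu$ are real for $t\ge b$, with $\lambda(b)=\mu(b)$ and $\lambda(t)<\mu(t)$ for $t>b$ (a Hopf bifurcation at $a$ followed by a focus–node bifurcation at $b$). Put $R(t)=\Re\int_a^t\lambda(\tau)\,d\tau$ for real $t\in\,]t_m,b]$. Let $\varepsilon>0$ tend to $0$ (along the full limit $\varepsilon\to0^+$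 or, more generally, along any fixed proper filter converging to $0^+$, for instance a sequence or an ultrafilter). A trajectory is a family of maximal real solutions $X(\cdot,\varepsilon)$ of $\varepsilon\dot X=f(t,X,\varepsilon)$, one for each small $\varepsilon$. It goes along the slow curve on $]t_1,t_2[\,\subset\,]t_m,t_M[$ if on each compact subinterval of $]t_1,t_2[$ the solution $X(\cdot,\varepsilon)$ is defined for all small $\varepsilon$ and converges uniformly to $\varphi$. Say that a trajectory is early at a real $t$ if $t<a$, $R(t)>R(b)$, and it goes along the slow curve in a neighborhood of $t$. Say that a trajectory has property (C) if, whenever it is early at some $t$, it does not go along the slow curve after $b$, i.e. there is no $t_2>b$ such that it goes along the slow curve on $]t,t_2[$. If there is a trajectory that is early at some $t$ and has property (C), then every trajectory has property (C). -/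

import Mathlib

open Filter Topology

/-- A real vector of `ℝ²` seen in `ℂ²`. -/
def complexify (x : Fin 2 → ℝ) : Fin 2 → ℂ := fun i => (x i : ℂ)

/-- A slow-fast system `ε X' = f(t, X, ε)` with a slow curve `X = φ(t)` along which a Hopf
bifurcation (at `a`) is followed by a focus-node bifurcation (at `b`). -/
structure HFNSystem where
  /-- the domain of `f` -/
  D : Set (ℂ × (Fin 2 → ℂ) × ℂ)
  /-- the right-hand side -/
  f : ℂ × (Fin 2 → ℂ) × ℂ → (Fin 2 → ℂ)
  isOpen_D : IsOpen D
  isConnected_D : IsConnected D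
  analytic_f : AnalyticOnNhd ℂ f D
  /-- `f` takes real values when its arguments are real -/
  real_f : ∀ (t : ℝ) (x : Fin 2 → ℝ) (ε : ℝ), ((t : ℂ), complexify x, (ε : ℂ)) ∈ D →
    ∃ v : Fin 2 → ℝ, f ((t : ℂ), complexify x, (ε : ℂ)) = complexify v
  /-- the (complex) domain of the slow curve -/
  Dt : Set ℂ
  /-- the slow curve -/
  φ : ℂ → (Fin 2 → ℂ)
  isOpen_Dt : IsOpen Dt
  isConnected_Dt : IsConnected Dt
  analytic_φ : AnalyticOnNhd ℂ φ Dt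
  slow_mem : ∀ z ∈ Dt, (z, φ z, (0 : ℂ)) ∈ D
  slow_eq : ∀ z ∈ Dt, f (z, φ z, 0) = 0
  /-- lower end of the real trace of `Dt`, possibly `-∞` -/
  tm : EReal
  /-- upper end of the real trace of `Dt`, possibly `+∞` -/
  tM : EReal
  real_trace : ∀ t : ℝ, (t : ℂ) ∈ Dt ↔ tm < (t : EReal) ∧ (t : EReal) < tM
  /-- the Hopf bifurcation point -/
  a : ℝ
  /-- the focus-node bifurcation point -/
  b : ℝ
  tm_lt_a : tm < (a : EReal)
  a_lt_b : a < b
  b_lt_tM : (b : EReal) < tM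
  /-- first eigenvalue of the Jacobian matrix along the real slow curve -/
  lam : ℝ → ℂ
  /-- second eigenvalue of the Jacobian matrix along the real slow curve -/
  mu : ℝ → ℂ
  /-- `lam t`, `mu t` are the eigenvalues, with multiplicity, of `D_X f (t, φ(t), 0)` -/
  eigenvalues : ∀ t : ℝ, (t : ℂ) ∈ Dt →
    (LinearMap.toMatrix'
      (fderiv ℂ (fun x : Fin 2 → ℂ => f ((t : ℂ), x, (0 : ℂ))) (φ t)).toLinearMap).charpoly
      = (Polynomial.X - Polynomial.C (lam t)) * (Polynomial.X - Polynomial.C (mu t))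
  re_neg : ∀ t : ℝ, (t : ℂ) ∈ Dt → t < a → (lam t).re < 0 ∧ (mu t).re < 0
  re_zero : (lam a).re = 0 ∧ (mu a).re = 0
  re_pos : ∀ t : ℝ, (t : ℂ) ∈ Dt → a < t → 0 < (lam t).re ∧ 0 < (mu t).re
  im_focus : ∀ t : ℝ, (t : ℂ) ∈ Dt → t < b → (lam t).im < 0 ∧ 0 < (mu t).im
  im_node : ∀ t : ℝ, (t : ℂ) ∈ Dt → b ≤ t → (lam t).im = 0 ∧ (mu t).im = 0
  eq_at_b : lam b = mu b
  lt_after_b : ∀ t : ℝ, (t : ℂ) ∈ Dt → b < t → (lam t).re < (mu t).re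

namespace HFNSystem

/-- The relief on the real axis, `R(t) = Re ∫_a^t λ(τ) dτ`; it is only used for `t ≤ b`,
where `Re λ = Re μ`. -/
noncomputable def R (S : HFNSystem) (t : ℝ) : ℝ := (∫ τ in S.a..t, S.lam τ).re

/-- `X` is a real solution of `ε X' = f(t, X, ε)` on the open interval `I`. -/
structure IsSolution (S : HFNSystem) (ε : ℝ) (I : Set ℝ) (X : ℝ → Fin 2 → ℝ) : Prop where
  nonempty : I.Nonempty
  isOpen : IsOpen I
  interval : I.OrdConnected
  mem : ∀ t ∈ I, ((t : ℂ), complexify (X t), (ε : ℂ)) ∈ S.D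
  ode : ∀ t ∈ I, ∃ V : Fin 2 → ℝ, HasDerivAt X V t ∧
    complexify (ε • V) = S.f ((t : ℂ), complexify (X t), (ε : ℂ))

/-- `X` is a solution on `I` that cannot be extended to a larger open interval. -/
structure IsMaximalSolution (S : HFNSystem) (ε : ℝ) (I : Set ℝ) (X : ℝ → Fin 2 → ℝ) : Prop where
  isSolution : S.IsSolution ε I X
  maximal : ∀ (J : Set ℝ) (Y : ℝ → Fin 2 → ℝ), S.IsSolution ε J Y → I ⊆ J → Set.EqOn X Y I →
    J = I

/-- A trajectory of the system: for each small `ε` (small in the sense of the filter `l`, along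
which `ε` tends to zero), a maximal real solution. -/
structure Trajectory (S : HFNSystem) (l : Filter ℝ) where
  /-- the interval of definition -/
  I : ℝ → Set ℝ
  /-- the solution, as a function of `ε` and `t` -/
  X : ℝ → ℝ → Fin 2 → ℝ
  isMaximal : ∀ᶠ ε in l, S.IsMaximalSolution ε (I ε) (X ε)

namespace Trajectory

/-- The trajectory goes along the slow curve (at least) on `]t₁, t₂[`: it is infinitely close to
the slow curve, uniformly on each compact subinterval of `]t₁, t₂[`. -/
def GoesAlong {S : HFNSystem} {l : Filter ℝ} (T : S.Trajectory l) (t₁ t₂ : ℝ) : Prop :=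
  (∀ t ∈ Set.Ioo t₁ t₂, (t : ℂ) ∈ S.Dt) ∧
  ∀ s₁ s₂ : ℝ, t₁ < s₁ → s₂ < t₂ → ∀ η > 0, ∀ᶠ ε in l, ∀ t ∈ Set.Icc s₁ s₂,
    t ∈ T.I ε ∧ ‖complexify (T.X ε t) - S.φ t‖ < η

/-- The trajectory goes along the slow curve in a neighborhood of the real `t`, where `t < a` and
`R(t) > R(b)`. -/
def EarlyAt {S : HFNSystem} {l : Filter ℝ} (T : S.Trajectory l) (t : ℝ) : Prop :=
  t < S.a ∧ S.R S.b < S.R t ∧ ∃ t₁ t₂ : ℝ, t₁ < t ∧ t < t₂ ∧ T.GoesAlong t₁ t₂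

/-- If the trajectory goes along the slow curve in a neighborhood of a real `t` with `t < a` and
`R(t) > R(b)`, then it does not go along the slow curve from there until after `b`. -/
def StopsAtFocusNode {S : HFNSystem} {l : Filter ℝ} (T : S.Trajectory l) : Prop :=
  ∀ t : ℝ, T.EarlyAt t → ¬ ∃ t₂ : ℝ, S.b < t₂ ∧ T.GoesAlong t t₂

end Trajectory

end HFNSystem

/-! The argument is by contraposition: if one early trajectory `T'` follows the slow curve beyond
`b`, then so does every early trajectory `T`. Before `a` the slow curve attracts
(`CloseOn.attracted`), so both trajectories are close to it at a common time `s < a` with `R(s) >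
R(b)`.

From `s` on, `T` is compared with `T'` and not with the slow curve. The slow curve solves the
equation only approximately, and beyond `a` its residual would be amplified. The difference `Y` of
two exact solutions has no such forcing: `ε Y' = (A(t) + small) Y`, where `A` is the Jacobian matrix
along the slow curve.

Up to `b` the eigenvalues of `A` share their real part, so `‖Y‖²` grows at the rate `tr A / ε`, and
the integral of `tr A` is `2R` (`two_mul_R`). Slightly beyond `b` the eigenvalues separate, but the
discriminant stays small, which costs an arbitrarily small `δ` in the rate. The quadratic Lyapunov
function of `exists_lyapunov` makes this precise uniformly across `b`. Since `R(b) < R(s)`, the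
integrated rate is still negative a little after `b` (`CloseOn.follow`). The bootstrap in
`CloseOn.transfer` then keeps `T` defined and close to `T'`, hence to the slow curve, beyond `b`. -/

/-! ### Differential equations: extension of solutions, linearization, Grönwall -/

/-- Local solvability of a non-autonomous `C¹` equation. -/
theorem exists_local_solution {E : Type*} [NormedAddCommGroup E] [NormedSpace ℝ E]
    [CompleteSpace E] {h : ℝ × E → E} {τ : ℝ} {x : E} (hh : ContDiffAt ℝ 1 h (τ, x)) :
    ∃ Z : ℝ → E, Z τ = x ∧ ∃ e > (0 : ℝ),
      ∀ t ∈ Set.Ioo (τ - e) (τ + e), HasDerivAt Z (h (t, Z t)) t := by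
  -- Time becomes a state variable of speed 1, which makes the equation autonomous.
  have hF : ContDiffAt ℝ 1 (fun z : ℝ × E => ((1 : ℝ), h z)) (τ, x) :=
    contDiffAt_const.prodMk hh
  obtain ⟨α, hα, e, he, hd⟩ :=
    hF.exists_forall_mem_closedBall_exists_eq_forall_mem_Ioo_hasDerivAt₀ τ
  have h1 : ∀ t ∈ Set.Ioo (τ - e) (τ + e), (α t).1 = t := by
    intro t ht
    have hconst : ∀ u ∈ Set.Ioo (τ - e) (τ + e), HasDerivAt (fun u => (α u).1 - u) 0 u := by
      intro u hu
      have := ((hasFDerivAt_fst (p := α u)).comp_hasDerivAt u (hd u hu)).sub (hasDerivAt_id u)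
      simpa using! this
    have hτ : τ ∈ Set.Ioo (τ - e) (τ + e) := ⟨by linarith, by linarith⟩
    have := (convex_Ioo (τ - e) (τ + e)).is_const_of_fderivWithin_eq_zero (𝕜 := ℝ)
      (f := fun u => (α u).1 - u)
      (fun u hu => (hconst u hu).differentiableAt.differentiableWithinAt) ?_ ht hτ
    · have h0 : (α τ).1 = τ := by rw [hα]
      simp only [h0, sub_self] at this
      linarith
    · intro u hu
      rw [fderivWithin_of_isOpen isOpen_Ioo hu]
      ext
      simpa using! (hconst u hu).deriv
  refine ⟨fun t => (α t).2, by simp [hα], e, he, fun t ht => ?_⟩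
  have := (hasFDerivAt_snd (p := α t)).comp_hasDerivAt t (hd t ht)
  have h2 : α t = (t, (α t).2) := Prod.ext (h1 t ht) rfl
  rw [h2] at this
  simpa using! this

/-- A solution staying in a compact subset of the domain up to a finite time `τ` extends beyond
`τ`. -/
theorem exists_extension {ι : Type*} [Fintype ι] {Ω K : Set (ℝ × (ι → ℝ))} (hΩ : IsOpen Ω)
    {h : ℝ × (ι → ℝ) → (ι → ℝ)} (hh : ∀ z ∈ Ω, ContDiffAt ℝ 1 h z) (hK : IsCompact K)
    (hKΩ : K ⊆ Ω) {s τ : ℝ} (hs : s < τ) {X : ℝ → ι → ℝ}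
    (hX : ∀ t ∈ Set.Ico s τ, HasDerivAt X (h (t, X t)) t)
    (hXK : ∀ t ∈ Set.Ico s τ, (t, X t) ∈ K) :
    ∃ e > (0 : ℝ), ∃ Y : ℝ → ι → ℝ, Set.EqOn X Y (Set.Iio τ) ∧
      ∀ t ∈ Set.Ioo s (τ + e), (t, Y t) ∈ Ω ∧ HasDerivAt Y (h (t, Y t)) t := by
  have hcont : ContinuousOn h K := fun z hz => (hh z (hKΩ hz)).continuousAt.continuousWithinAt
  obtain ⟨C, hC⟩ := hK.exists_bound_of_continuousOn hcont
  -- Bounded speed makes `X` Lipschitz; a Lipschitz extension `G` supplies the limit of `X` at `τ`.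
  have hlip : LipschitzOnWith C.toNNReal X (Set.Ico s τ) :=
    (convex_Ico s τ).lipschitzOnWith_of_nnnorm_hasDerivWithin_le
      (fun t ht => (hX t ht).hasDerivWithinAt) fun t ht => by
        rw [← NNReal.coe_le_coe, coe_nnnorm]
        exact (hC _ (hXK t ht)).trans (Real.le_coe_toNNReal C)
  obtain ⟨G, hG, hGX⟩ := hlip.extend_pi
  have hev : ∀ᶠ t in 𝓝[<] τ, t ∈ Set.Ico s τ := Ico_mem_nhdsLT hs
  have hlim : Tendsto X (𝓝[<] τ) (𝓝 (G τ)) :=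
    (hG.continuous.continuousAt.tendsto.mono_left nhdsWithin_le_nhds).congr'
      (hev.mono fun t ht => (hGX ht).symm)
  have hlim2 : Tendsto (fun t => (t, X t)) (𝓝[<] τ) (𝓝 (τ, G τ)) :=
    (tendsto_id.mono_right nhdsWithin_le_nhds).prodMk_nhds hlim
  have hmem : (τ, G τ) ∈ Ω :=
    hKΩ (hK.isClosed.mem_of_tendsto hlim2 (hev.mono fun t ht => hXK t ht))
  obtain ⟨Z, hZτ, e, he, hZ⟩ := exists_local_solution (hh _ hmem)
  have hZc : ContinuousAt Z τ := (hZ τ ⟨by linarith, by linarith⟩).continuousAt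
  have hZΩ : ∀ᶠ t in 𝓝 τ, (t, Z t) ∈ Ω := by
    have : ContinuousAt (fun t => (t, Z t)) τ := continuousAt_id.prodMk hZc
    exact this.eventually_mem (hΩ.mem_nhds (by rw [hZτ]; exact hmem))
  obtain ⟨e', he', hball⟩ := Metric.eventually_nhds_iff.1 hZΩ
  set Y : ℝ → ι → ℝ := fun t => if t < τ then X t else Z t with hYdef
  have hY1 : ∀ t < τ, Y t = X t := fun t ht => by simp [hYdef, ht]
  have hY2 : ∀ t, τ ≤ t → Y t = Z t := fun t ht => by simp [hYdef, not_lt.2 ht]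
  refine ⟨min e e', lt_min he he', Y, fun t ht => (hY1 t ht).symm, fun t ht => ?_⟩
  have hte : t < τ + e := ht.2.trans_le (by gcongr; exact min_le_left _ _)
  have hte' : t < τ + e' := ht.2.trans_le (by gcongr; exact min_le_right _ _)
  rcases lt_trichotomy t τ with htτ | htτ | htτ
  · rw [hY1 t htτ]
    refine ⟨hKΩ (hXK t ⟨ht.1.le, htτ⟩), (hX t ⟨ht.1.le, htτ⟩).congr_of_eventuallyEq ?_⟩
    filter_upwards [Iio_mem_nhds htτ] with u hu using hY1 u hu
  · subst htτ
    rw [hY2 t le_rfl, hZτ]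
    refine ⟨hmem, ?_⟩
    have hYlim : Tendsto Y (𝓝[<] t) (𝓝 (G t)) := hlim.congr' (by
      filter_upwards [self_mem_nhdsWithin] with u hu using (hY1 u hu).symm)
    have hYd : ∀ u ∈ Set.Ico s t, HasDerivAt Y (h (u, X u)) u := fun u hu =>
      (hX u hu).congr_of_eventuallyEq (by
        filter_upwards [Iio_mem_nhds hu.2] with v hv using hY1 v hv)
    -- At the junction the left derivative is the limit of the derivatives of `X`, and it agrees
    -- with the right derivative coming from `Z`.
    have hleft : HasDerivWithinAt Y (h (t, G t)) (Set.Iic t) t := by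
      refine hasDerivWithinAt_Iic_of_tendsto_deriv (s := Set.Ico s t)
        (fun u hu => (hYd u hu).differentiableAt.differentiableWithinAt) ?_
        (Ico_mem_nhdsLT hs) ?_
      · have : Tendsto Y (𝓝[Set.Ico s t] t) (𝓝 (Y t)) := by
          rw [hY2 t le_rfl, hZτ]
          exact hYlim.mono_left (nhdsWithin_mono _ fun u hu => hu.2)
        exact this
      · refine ((hh _ hmem).continuousAt.tendsto.comp hlim2).congr' ?_
        filter_upwards [hev] with u hu using (hYd u hu).deriv.symm
    have hright : HasDerivWithinAt Y (h (t, G t)) (Set.Ici t) t := by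
      have := (hZ t ⟨by linarith, by linarith⟩).hasDerivWithinAt (s := Set.Ici t)
      rw [hZτ] at this
      exact this.congr (fun u hu => hY2 u hu) (hY2 t le_rfl)
    simpa using hleft.union hright
  · rw [hY2 t htτ.le]
    refine ⟨hball (by rw [Real.dist_eq, abs_of_pos (by linarith)]; linarith), ?_⟩
    refine (hZ t ⟨by linarith, hte⟩).congr_of_eventuallyEq ?_
    filter_upwards [Ioi_mem_nhds htτ] with u hu using hY2 u (le_of_lt hu)

/-- Uniform linearization along a compact arc of the curve `(t, ψ t, 0)`. -/
theorem eventually_linearization {E : Type*} [NormedAddCommGroup E] [NormedSpace ℝ E]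
    {g : ℝ × E × ℝ → E} {ψ : ℝ → E} {K : Set ℝ} (hK : IsCompact K)
    (hψ : ∀ t ∈ K, ContinuousAt ψ t) (hg : ∀ t ∈ K, ContDiffAt ℝ 1 g (t, ψ t, 0))
    {ω : ℝ} (hω : 0 < ω) :
    ∀ᶠ q : E × E × ℝ in 𝓝 0, ∀ t ∈ K,
      ‖g (t, ψ t + q.1, q.2.2) - g (t, ψ t + q.2.1, q.2.2)
        - fderiv ℝ g (t, ψ t, 0) (0, q.1 - q.2.1, 0)‖ ≤ ω * ‖q.1 - q.2.1‖ := by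
  refine hK.eventually_forall_of_forall_eventually (P := fun (q : E × E × ℝ) (t : ℝ) =>
      ‖g (t, ψ t + q.1, q.2.2) - g (t, ψ t + q.2.1, q.2.2)
        - fderiv ℝ g (t, ψ t, 0) (0, q.1 - q.2.1, 0)‖ ≤ ω * ‖q.1 - q.2.1‖) fun t ht => ?_
  have hs := (hg t ht).hasStrictFDerivAt one_ne_zero
  -- One half of `ω` pays for strict differentiability at the fixed base point, the other half for
  -- moving the base point of the derivative.
  have h1 := hs.isLittleO.def (c := ω / 2) (by positivity)
  have hc1 : ContinuousAt (fun z : (E × E × ℝ) × ℝ => ψ z.2) (0, t) :=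
    ContinuousAt.comp (f := fun z : (E × E × ℝ) × ℝ => z.2) (hψ t ht) continuousAt_snd
  have hc : Tendsto (fun z : (E × E × ℝ) × ℝ =>
      ((z.2, ψ z.2 + z.1.1, z.1.2.2), (z.2, ψ z.2 + z.1.2.1, z.1.2.2))) (𝓝 (0, t))
      (𝓝 ((t, ψ t, 0), (t, ψ t, 0))) := by
    have : ContinuousAt (fun z : (E × E × ℝ) × ℝ =>
      ((z.2, ψ z.2 + z.1.1, z.1.2.2), (z.2, ψ z.2 + z.1.2.1, z.1.2.2))) (0, t) := by
      fun_prop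
    simpa [ContinuousAt] using! this
  have hdc : ContinuousAt (fun z : (E × E × ℝ) × ℝ => fderiv ℝ g (z.2, ψ z.2, 0)) (0, t) := by
    have hd : ContinuousAt (fderiv ℝ g) (t, ψ t, 0) :=
      ((hg t ht).fderiv_right (m := 0) (by norm_num)).continuousAt
    refine ContinuousAt.comp (f := fun z : (E × E × ℝ) × ℝ => (z.2, ψ z.2, (0 : ℝ))) hd ?_
    fun_prop
  have h2 : ∀ᶠ z : (E × E × ℝ) × ℝ in 𝓝 (0, t),
      ‖fderiv ℝ g (z.2, ψ z.2, 0) - fderiv ℝ g (t, ψ t, 0)‖ < ω / 2 := by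
    have := Metric.tendsto_nhds.1 hdc (ω / 2) (by positivity)
    simpa [dist_eq_norm] using this
  filter_upwards [hc.eventually h1, h2] with z hz1 hz2
  have hn : ‖((0 : ℝ), z.1.1 - z.1.2.1, (0 : ℝ))‖ = ‖z.1.1 - z.1.2.1‖ := by
    simp [Prod.norm_def]
  have e1 : (z.2, ψ z.2 + z.1.1, z.1.2.2) - (z.2, ψ z.2 + z.1.2.1, z.1.2.2)
      = ((0 : ℝ), z.1.1 - z.1.2.1, (0 : ℝ)) := by
    simp
  simp only [e1, hn] at hz1
  have hz3 := (fderiv ℝ g (z.2, ψ z.2, 0) - fderiv ℝ g (t, ψ t, 0)).le_of_opNorm_le hz2.le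
    ((0 : ℝ), z.1.1 - z.1.2.1, (0 : ℝ))
  rw [hn, sub_apply] at hz3
  calc _ = ‖(g (z.2, ψ z.2 + z.1.1, z.1.2.2) - g (z.2, ψ z.2 + z.1.2.1, z.1.2.2)
        - fderiv ℝ g (t, ψ t, 0) (0, z.1.1 - z.1.2.1, 0))
        - (fderiv ℝ g (z.2, ψ z.2, 0) (0, z.1.1 - z.1.2.1, 0)
          - fderiv ℝ g (t, ψ t, 0) (0, z.1.1 - z.1.2.1, 0))‖ := by congr 1; abel
    _ ≤ _ := (norm_sub_le _ _).trans (by linarith)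

/-- Differential form of Grönwall's inequality with a variable rate. -/
theorem le_mul_exp_of_hasDerivAt_le {W W' κ κ' : ℝ → ℝ} {s t : ℝ} (hst : s ≤ t)
    (hW : ∀ u ∈ Set.Icc s t, HasDerivAt W (W' u) u)
    (hκ : ∀ u ∈ Set.Icc s t, HasDerivAt κ (κ' u) u)
    (hle : ∀ u ∈ Set.Icc s t, W' u ≤ κ' u * W u) :
    W t ≤ W s * Real.exp (κ t - κ s) := by
  have hd : ∀ u ∈ Set.Icc s t, HasDerivAt (fun u => W u * Real.exp (-κ u))
      (W' u * Real.exp (-κ u) + W u * (Real.exp (-κ u) * (-κ' u))) u :=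
    fun u hu => (hW u hu).mul (hκ u hu).neg.exp
  have hanti : AntitoneOn (fun u => W u * Real.exp (-κ u)) (Set.Icc s t) := by
    refine antitoneOn_of_deriv_nonpos (convex_Icc s t)
      (fun u hu => (hd u hu).continuousAt.continuousWithinAt)
      (fun u hu => (hd u (interior_subset hu)).differentiableAt.differentiableWithinAt) ?_
    intro u hu
    have hu' := interior_subset hu
    rw [(hd u hu').deriv]
    nlinarith [hle u hu', Real.exp_pos (-κ u)]
  have h := hanti (Set.left_mem_Icc.2 hst) (Set.right_mem_Icc.2 hst) hst
  have h' := mul_le_mul_of_nonneg_right h (Real.exp_pos (κ t)).le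
  simp only [mul_assoc, ← Real.exp_add, neg_add_cancel, Real.exp_zero, mul_one] at h'
  rwa [show κ t - κ s = -κ s + κ t by ring]

/-! ### The quadratic Lyapunov function -/

/-- Let `B` be the traceless part of the matrix and `d = ((a11 - a22) / 2) ^ 2 + a12 * a21`, so that
`B² = d·1`. The form on the right is `(δ² - d)|y|² + |By|²` in Euclidean norms, and `δ² - d ≥ δ² /
2`. -/
theorem quadratic_coercive {a11 a12 a21 a22 δ y1 y2 : ℝ}
    (hd : ((a11 - a22) / 2) ^ 2 + a12 * a21 ≤ δ ^ 2 / 2) :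
    δ ^ 2 / 2 * (y1 ^ 2 + y2 ^ 2) ≤
      (δ ^ 2 - a12 * a21 + a21 ^ 2) * y1 ^ 2 + 2 * ((a11 - a22) / 2 * (a12 - a21)) * (y1 * y2)
        + (δ ^ 2 - a12 * a21 + a12 ^ 2) * y2 ^ 2 := by
  nlinarith [mul_nonneg (sub_nonneg.2 hd) (add_nonneg (sq_nonneg y1) (sq_nonneg y2)),
    sq_nonneg ((a11 - a22) / 2 * y1 + a12 * y2), sq_nonneg (a21 * y1 - (a11 - a22) / 2 * y2)]

/-- With `W = (δ² - d)|y|² + |By|²`, the relation `B² = d·1` cancels `d` from the derivative of `W`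
along `y' = By`, leaving `2δ² y·By`. This is at most `2δW`. The scalar part of the matrix
contributes exactly `(a11 + a22) W`. -/
theorem quadratic_drift_le {a11 a12 a21 a22 δ y1 y2 : ℝ} (hδ : 0 < δ)
    (hd : ((a11 - a22) / 2) ^ 2 + a12 * a21 ≤ δ ^ 2 / 2) :
    2 * (((δ ^ 2 - a12 * a21 + a21 ^ 2) * y1 + (a11 - a22) / 2 * (a12 - a21) * y2)
          * (a11 * y1 + a12 * y2)
        + ((a11 - a22) / 2 * (a12 - a21) * y1 + (δ ^ 2 - a12 * a21 + a12 ^ 2) * y2)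
          * (a21 * y1 + a22 * y2)) ≤
      (a11 + a22 + 2 * δ) *
        ((δ ^ 2 - a12 * a21 + a21 ^ 2) * y1 ^ 2 + 2 * ((a11 - a22) / 2 * (a12 - a21)) * (y1 * y2)
        + (δ ^ 2 - a12 * a21 + a12 ^ 2) * y2 ^ 2) := by
  set p := (a11 - a22) / 2 with hp
  have e : a11 = a22 + 2 * p := by rw [hp]; ring
  -- The right side equals `2W - 2δ y·By`, written as a sum of nonnegative terms.
  have key : 0 ≤ 2 * (δ ^ 2 / 2 - (p ^ 2 + a12 * a21)) * (y1 ^ 2 + y2 ^ 2)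
      + ((p * y1 + a12 * y2) ^ 2 + (a21 * y1 - p * y2) ^ 2)
      + (δ * y1 - (p * y1 + a12 * y2)) ^ 2 + (δ * y2 - (a21 * y1 - p * y2)) ^ 2 := by
    have := sub_nonneg.2 hd
    positivity
  have key2 := mul_nonneg hδ.le key
  rw [e]
  linear_combination key2

/-- A quadratic Lyapunov function for `ε Y' = A(t) Y + E` whose rate is the trace of `A`, up to
small errors, as long as the discriminant of `A` is almost nonpositive. -/
theorem exists_lyapunov {p q δ : ℝ} {A : ℝ → Matrix (Fin 2) (Fin 2) ℝ}
    (hA : ∀ t ∈ Set.Icc p q, ∀ i j, ContDiffAt ℝ 1 (fun t => A t i j) t) (hδ : 0 < δ)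
    (hd : ∀ t ∈ Set.Icc p q,
      ((A t 0 0 - A t 1 1) / 2) ^ 2 + A t 0 1 * A t 1 0 ≤ δ ^ 2 / 2) :
    ∃ W : ℝ → (Fin 2 → ℝ) → ℝ, ∃ c > 0, ∃ C > 0,
      (∀ t ∈ Set.Icc p q, ∀ y, c * ‖y‖ ^ 2 ≤ W t y ∧ W t y ≤ C * ‖y‖ ^ 2) ∧
      ∀ ε ω ρ : ℝ, 0 < ε → 0 ≤ ω → 0 ≤ ρ → ∀ (Y : ℝ → Fin 2 → ℝ) (V : Fin 2 → ℝ),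
        ∀ t ∈ Set.Icc p q, HasDerivAt Y V t →
        ‖ε • V - (A t).mulVec (Y t)‖ ≤ ω * ‖Y t‖ + ρ →
        ∃ W', HasDerivAt (fun t => W t (Y t)) W' t ∧
          ε * W' ≤ (A t 0 0 + A t 1 1 + 3 * δ + C * (ε + ω)) * W t (Y t) + C * ρ ^ 2 := by
  set α : ℝ → ℝ := fun t => δ ^ 2 - A t 0 1 * A t 1 0 + A t 1 0 ^ 2 with hα
  set β : ℝ → ℝ := fun t => (A t 0 0 - A t 1 1) / 2 * (A t 0 1 - A t 1 0) with hβ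
  set γ : ℝ → ℝ := fun t => δ ^ 2 - A t 0 1 * A t 1 0 + A t 0 1 ^ 2 with hγ
  have hαs : ∀ t ∈ Set.Icc p q, ContDiffAt ℝ 1 α t := fun t ht =>
    (contDiffAt_const.sub ((hA t ht 0 1).mul (hA t ht 1 0))).add ((hA t ht 1 0).pow 2)
  have hβs : ∀ t ∈ Set.Icc p q, ContDiffAt ℝ 1 β t := fun t ht =>
    (((hA t ht 0 0).sub (hA t ht 1 1)).div_const 2).mul ((hA t ht 0 1).sub (hA t ht 1 0))
  have hγs : ∀ t ∈ Set.Icc p q, ContDiffAt ℝ 1 γ t := fun t ht =>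
    (contDiffAt_const.sub ((hA t ht 0 1).mul (hA t ht 1 0))).add ((hA t ht 0 1).pow 2)
  have bound : ∀ u : ℝ → ℝ, (∀ t ∈ Set.Icc p q, ContDiffAt ℝ 1 u t) →
      ∃ M > 0, ∀ t ∈ Set.Icc p q, |u t| ≤ M ∧ |deriv u t| ≤ M ∧ HasDerivAt u (deriv u t) t := by
    intro u hu
    obtain ⟨M1, h1⟩ := isCompact_Icc.exists_bound_of_continuousOn
      (fun t ht => (hu t ht).continuousAt.continuousWithinAt)
    have hdu : ∀ t ∈ Set.Icc p q, ContinuousAt (deriv u) t := by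
      intro t ht
      have hc : ContinuousAt (fderiv ℝ u) t :=
        ((hu t ht).fderiv_right (m := 0) (by norm_num)).continuousAt
      exact hc.clm_apply continuousAt_const
    obtain ⟨M2, h2⟩ := isCompact_Icc.exists_bound_of_continuousOn
      (fun t ht => (hdu t ht).continuousWithinAt)
    refine ⟨max 1 (max M1 M2), by positivity, fun t ht => ⟨?_, ?_, ?_⟩⟩
    · exact (h1 t ht).trans (by simp)
    · exact (h2 t ht).trans (by simp)
    · exact ((hu t ht).differentiableAt one_ne_zero).hasDerivAt
  obtain ⟨M1, hM1, h1⟩ := bound α hαs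
  obtain ⟨M2, hM2, h2⟩ := bound β hβs
  obtain ⟨M3, hM3, h3⟩ := bound γ hγs
  set M := M1 + M2 + M3 with hM
  have hMpos : 0 < M := by positivity
  have hcoord : ∀ y : Fin 2 → ℝ, |y 0| ≤ ‖y‖ ∧ |y 1| ≤ ‖y‖ :=
    fun y => ⟨norm_le_pi_norm y 0, norm_le_pi_norm y 1⟩
  have hquad : ∀ (a b c : ℝ) (y : Fin 2 → ℝ), |a| ≤ M → |b| ≤ M → |c| ≤ M →
      a * y 0 ^ 2 + 2 * b * (y 0 * y 1) + c * y 1 ^ 2 ≤ 4 * M * ‖y‖ ^ 2 := by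
    intro a b c y ha hb hc
    obtain ⟨h0, h1⟩ := hcoord y
    have hn := norm_nonneg y
    have e0 : y 0 ^ 2 ≤ ‖y‖ ^ 2 := sq_le_sq' (abs_le.1 h0).1 (abs_le.1 h0).2
    have e1 : y 1 ^ 2 ≤ ‖y‖ ^ 2 := sq_le_sq' (abs_le.1 h1).1 (abs_le.1 h1).2
    have e2 : |y 0 * y 1| ≤ ‖y‖ ^ 2 := by
      rw [abs_mul, sq]; exact mul_le_mul h0 h1 (abs_nonneg _) hn
    have f0 : a * y 0 ^ 2 ≤ M * ‖y‖ ^ 2 :=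
      mul_le_mul ((le_abs_self a).trans ha) e0 (sq_nonneg _) hMpos.le
    have f1 : c * y 1 ^ 2 ≤ M * ‖y‖ ^ 2 :=
      mul_le_mul ((le_abs_self c).trans hc) e1 (sq_nonneg _) hMpos.le
    have f2 : b * (y 0 * y 1) ≤ M * ‖y‖ ^ 2 := by
      refine (le_abs_self _).trans ?_
      rw [abs_mul]
      exact mul_le_mul hb e2 (abs_nonneg _) hMpos.le
    linarith
  have hlow : ∀ t ∈ Set.Icc p q, ∀ y : Fin 2 → ℝ, δ ^ 2 / 2 * ‖y‖ ^ 2 ≤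
      α t * y 0 ^ 2 + 2 * β t * (y 0 * y 1) + γ t * y 1 ^ 2 := by
    intro t ht y
    refine le_trans ?_ (quadratic_coercive (hd t ht))
    have : ‖y‖ ^ 2 ≤ y 0 ^ 2 + y 1 ^ 2 := by
      have hn : ‖y‖ ≤ max |y 0| |y 1| := by
        rw [pi_norm_le_iff_of_nonneg (by positivity)]
        intro i
        fin_cases i <;> simp
      rcases max_cases |y 0| |y 1| with h | h <;> rw [h.1] at hn
      · have := pow_le_pow_left₀ (norm_nonneg y) hn 2
        rw [sq_abs] at this
        nlinarith [sq_nonneg (y 1)]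
      · have := pow_le_pow_left₀ (norm_nonneg y) hn 2
        rw [sq_abs] at this
        nlinarith [sq_nonneg (y 0)]
    gcongr
  set C := 4 * M + 16 * M / δ ^ 2 + 32 * M ^ 2 / δ ^ 3 with hC
  have hC1 : 4 * M ≤ C := by
    have : 0 ≤ 16 * M / δ ^ 2 + 32 * M ^ 2 / δ ^ 3 := by positivity
    linarith
  have hC2 : 16 * M / δ ^ 2 ≤ C := by
    have : 0 ≤ 4 * M + 32 * M ^ 2 / δ ^ 3 := by positivity
    linarith
  have hC3 : 32 * M ^ 2 / δ ^ 3 ≤ C := by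
    have : 0 ≤ 4 * M + 16 * M / δ ^ 2 := by positivity
    linarith
  refine ⟨fun t y => α t * y 0 ^ 2 + 2 * β t * (y 0 * y 1) + γ t * y 1 ^ 2, δ ^ 2 / 2,
    by positivity, C, by positivity, fun t ht y => ⟨hlow t ht y, ?_⟩, ?_⟩
  · refine (hquad _ _ _ y ((h1 t ht).1.trans ?_) ((h2 t ht).1.trans ?_)
      ((h3 t ht).1.trans ?_)).trans ?_
    · linarith
    · linarith
    · linarith
    · gcongr
  · intro ε ω ρ hε hω hρ Y V t ht hY hE
    have hY0 : HasDerivAt (fun t => Y t 0) (V 0) t := (hasDerivAt_pi.1 hY) 0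
    have hY1 : HasDerivAt (fun t => Y t 1) (V 1) t := (hasDerivAt_pi.1 hY) 1
    obtain ⟨hα1, hα2, hα3⟩ := h1 t ht
    obtain ⟨hβ1, hβ2, hβ3⟩ := h2 t ht
    obtain ⟨hγ1, hγ2, hγ3⟩ := h3 t ht
    refine ⟨_, ((hα3.mul (hY0.pow 2)).add ((hβ3.const_mul 2).mul (hY0.mul hY1))).add
      (hγ3.mul (hY1.pow 2)), ?_⟩
    set N := ‖Y t‖ with hN
    have hN0 : 0 ≤ N := norm_nonneg _
    set W := α t * Y t 0 ^ 2 + 2 * β t * (Y t 0 * Y t 1) + γ t * Y t 1 ^ 2 with hW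
    have hWN : N ^ 2 ≤ 2 / δ ^ 2 * W := by
      have := hlow t ht (Y t)
      rw [div_mul_eq_mul_div, le_div_iff₀ (by positivity)]
      linarith
    have q1 := hquad _ _ _ (Y t) (hα2.trans (by linarith)) (hβ2.trans (by linarith))
      (hγ2.trans (by linarith : _ ≤ M))
    obtain ⟨hy0, hy1⟩ := hcoord (Y t)
    obtain ⟨he0, he1⟩ := hcoord (ε • V - (A t).mulVec (Y t))
    set e0 := (ε • V - (A t).mulVec (Y t)) 0 with he0d
    set e1 := (ε • V - (A t).mulVec (Y t)) 1 with he1d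
    have hv0 : ε * V 0 = A t 0 0 * Y t 0 + A t 0 1 * Y t 1 + e0 := by
      simp [he0d]
    have hv1 : ε * V 1 = A t 1 0 * Y t 0 + A t 1 1 * Y t 1 + e1 := by
      simp [he1d]
    have drift := quadratic_drift_le (y1 := Y t 0) (y2 := Y t 1) hδ (hd t ht)
    have herr : ∀ a b e : ℝ, |a| ≤ M → |b| ≤ M → |e| ≤ ω * N + ρ →
        (a * Y t 0 + b * Y t 1) * e ≤ 2 * M * N * (ω * N + ρ) := by
      intro a b e ha hb he
      have : |a * Y t 0 + b * Y t 1| ≤ 2 * M * N := by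
        refine (abs_add_le _ _).trans ?_
        rw [abs_mul, abs_mul]
        have f1 := mul_le_mul ha hy0 (abs_nonneg _) hMpos.le
        have f2 := mul_le_mul hb hy1 (abs_nonneg _) hMpos.le
        linarith
      refine (le_abs_self _).trans ?_
      rw [abs_mul]
      exact mul_le_mul this he (abs_nonneg _) (by positivity)
    have r0 := herr (α t) (β t) e0 (hα1.trans (by linarith)) (hβ1.trans (by linarith))
      (he0.trans hE)
    have r1 := herr (β t) (γ t) e1 (hβ1.trans (by linarith)) (hγ1.trans (by linarith))
      (he1.trans hE)
    -- Young's inequality, weighted so that coercivity bounds the `N ^ 2` term by `δ * W`; this is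
    -- the third `δ` in the rate.
    have s1 : 8 * M * N * ρ ≤ δ ^ 3 / 2 * N ^ 2 + 32 * M ^ 2 / δ ^ 3 * ρ ^ 2 := by
      have hid : δ ^ 3 / 2 * N ^ 2 + 32 * M ^ 2 / δ ^ 3 * ρ ^ 2 - 8 * M * N * ρ
          = 1 / (2 * δ ^ 3) * (δ ^ 3 * N - 8 * M * ρ) ^ 2 := by
        field_simp
        ring
      have : 0 ≤ 1 / (2 * δ ^ 3) * (δ ^ 3 * N - 8 * M * ρ) ^ 2 := by positivity
      linarith
    have hW0 : 0 ≤ W := le_trans (by positivity) (hlow t ht (Y t))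
    have s2 : δ ^ 3 / 2 * N ^ 2 ≤ δ * W := by
      calc δ ^ 3 / 2 * N ^ 2 ≤ δ ^ 3 / 2 * (2 / δ ^ 2 * W) := by gcongr
        _ = δ * W := by field_simp
    have s3 : 8 * M * (ε + ω) * N ^ 2 ≤ C * (ε + ω) * W := by
      calc 8 * M * (ε + ω) * N ^ 2 ≤ 8 * M * (ε + ω) * (2 / δ ^ 2 * W) := by gcongr
        _ = 16 * M / δ ^ 2 * (ε + ω) * W := by ring
        _ ≤ C * (ε + ω) * W := by gcongr
    have s4 : 32 * M ^ 2 / δ ^ 3 * ρ ^ 2 ≤ C * ρ ^ 2 := by gcongr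
    have s5 := mul_le_mul_of_nonneg_left q1 hε.le
    have s6 : 0 ≤ 4 * M * ε * N ^ 2 := by positivity
    have hid : ε * (deriv α t * Y t 0 ^ 2 + α t * (2 * Y t 0 ^ (2 - 1) * V 0)
        + (2 * deriv β t * (Y t 0 * Y t 1) + 2 * β t * (V 0 * Y t 1 + Y t 0 * V 1))
        + (deriv γ t * Y t 1 ^ 2 + γ t * (2 * Y t 1 ^ (2 - 1) * V 1)))
      = ε * (deriv α t * Y t 0 ^ 2 + 2 * deriv β t * (Y t 0 * Y t 1) + deriv γ t * Y t 1 ^ 2)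
        + 2 * ((α t * Y t 0 + β t * Y t 1) * (ε * V 0)
          + (β t * Y t 0 + γ t * Y t 1) * (ε * V 1)) := by ring
    have hWeq : 2 * ((α t * Y t 0 + β t * Y t 1) * (A t 0 0 * Y t 0 + A t 0 1 * Y t 1)
        + (β t * Y t 0 + γ t * Y t 1) * (A t 1 0 * Y t 0 + A t 1 1 * Y t 1))
        ≤ (A t 0 0 + A t 1 1 + 2 * δ) * W := drift
    refine le_trans (le_of_eq ?_) (le_trans (le_of_eq hid) ?_)
    · simp
    · rw [hv0, hv1]
      linear_combination s5 + hWeq + 2 * r0 + 2 * r1 + s1 + s2 + s3 + s4 + s6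

/-! ### The real system underlying the complex one -/

/-- `complexify` as a real-linear map. -/
noncomputable def complexifyCLM : (Fin 2 → ℝ) →L[ℝ] (Fin 2 → ℂ) :=
  ContinuousLinearMap.pi fun i => Complex.ofRealCLM.comp (ContinuousLinearMap.proj i)

theorem complexifyCLM_apply (x : Fin 2 → ℝ) : complexifyCLM x = complexify x := rfl

/-- Componentwise real part, as a real-linear map. -/
noncomputable def realPartCLM : (Fin 2 → ℂ) →L[ℝ] (Fin 2 → ℝ) :=
  ContinuousLinearMap.pi fun i => Complex.reCLM.comp (ContinuousLinearMap.proj i)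

theorem realPartCLM_apply (z : Fin 2 → ℂ) (i : Fin 2) : realPartCLM z i = (z i).re := rfl

theorem realPartCLM_complexify (x : Fin 2 → ℝ) : realPartCLM (complexify x) = x := by
  ext i
  simp [realPartCLM_apply, complexify]

theorem norm_complexify (x : Fin 2 → ℝ) : ‖complexify x‖ = ‖x‖ := by
  simp [complexify, Pi.norm_def]

theorem complexify_sub (x y : Fin 2 → ℝ) : complexify x - complexify y = complexify (x - y) := by
  ext i
  simp [complexify]

/-- The embedding of the real phase space into the complex one. -/
noncomputable def realEmbedding : ℝ × (Fin 2 → ℝ) × ℝ →L[ℝ] ℂ × (Fin 2 → ℂ) × ℂ :=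
  Complex.ofRealCLM.prodMap (complexifyCLM.prodMap Complex.ofRealCLM)

theorem realEmbedding_apply (z : ℝ × (Fin 2 → ℝ) × ℝ) :
    realEmbedding z = ((z.1 : ℂ), complexify z.2.1, (z.2.2 : ℂ)) := rfl

namespace HFNSystem

/-- The vector field on the real phase space. -/
noncomputable def realField (S : HFNSystem) (z : ℝ × (Fin 2 → ℝ) × ℝ) : Fin 2 → ℝ :=
  realPartCLM (S.f (realEmbedding z))

/-- The real trace of the domain. -/
def realDomain (S : HFNSystem) : Set (ℝ × (Fin 2 → ℝ) × ℝ) := realEmbedding ⁻¹' S.D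

/-- The real part of the slow curve on the real axis. -/
noncomputable def realSlow (S : HFNSystem) (t : ℝ) : Fin 2 → ℝ := realPartCLM (S.φ t)

theorem isOpen_realDomain (S : HFNSystem) : IsOpen S.realDomain :=
  S.isOpen_D.preimage realEmbedding.continuous

theorem contDiffAt_realField (S : HFNSystem) {n : WithTop ℕ∞} {z : ℝ × (Fin 2 → ℝ) × ℝ}
    (hz : z ∈ S.realDomain) : ContDiffAt ℝ n S.realField z := by
  have h1 : ContDiffAt ℝ n S.f (realEmbedding z) :=
    ((S.analytic_f _ hz).restrictScalars (𝕜 := ℝ)).contDiffAt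
  exact realPartCLM.contDiff.contDiffAt.comp z
    (h1.comp z realEmbedding.contDiff.contDiffAt)

theorem complexify_realField (S : HFNSystem) {z : ℝ × (Fin 2 → ℝ) × ℝ}
    (hz : z ∈ S.realDomain) : complexify (S.realField z) = S.f (realEmbedding z) := by
  obtain ⟨v, hv⟩ := S.real_f z.1 z.2.1 z.2.2 hz
  rw [realField, realEmbedding_apply, hv, realPartCLM_complexify]

theorem contDiffAt_realSlow (S : HFNSystem) {n : WithTop ℕ∞} {t : ℝ} (ht : (t : ℂ) ∈ S.Dt) :
    ContDiffAt ℝ n S.realSlow t := by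
  have h1 : ContDiffAt ℝ n S.φ (Complex.ofRealCLM t) :=
    ((S.analytic_φ _ ht).restrictScalars (𝕜 := ℝ)).contDiffAt
  exact realPartCLM.contDiff.contDiffAt.comp t
    (h1.comp t Complex.ofRealCLM.contDiff.contDiffAt)

theorem isSolution_iff (S : HFNSystem) {ε : ℝ} (hε : ε ≠ 0) {I : Set ℝ} {X : ℝ → Fin 2 → ℝ} :
    S.IsSolution ε I X ↔ I.Nonempty ∧ IsOpen I ∧ I.OrdConnected ∧ ∀ t ∈ I,
      (t, X t, ε) ∈ S.realDomain ∧ HasDerivAt X (ε⁻¹ • S.realField (t, X t, ε)) t := by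
  constructor
  · rintro ⟨h1, h2, h3, h4, h5⟩
    refine ⟨h1, h2, h3, fun t ht => ⟨h4 t ht, ?_⟩⟩
    obtain ⟨V, hV, hVf⟩ := h5 t ht
    have : S.realField (t, X t, ε) = ε • V := by
      rw [realField, realEmbedding_apply, ← hVf, realPartCLM_complexify]
    rw [this, inv_smul_smul₀ hε]
    exact hV
  · rintro ⟨h1, h2, h3, h4⟩
    refine ⟨h1, h2, h3, fun t ht => (h4 t ht).1, fun t ht => ⟨_, (h4 t ht).2, ?_⟩⟩
    rw [smul_inv_smul₀ hε, S.complexify_realField (h4 t ht).1, realEmbedding_apply]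

/-! ### Maximal solutions and continuation in a tube -/

/-- A maximal solution leaves every compact subset of the domain at a finite end point. -/
theorem IsMaximalSolution.not_mem_compact {S : HFNSystem} {ε : ℝ} (hε : ε ≠ 0) {I : Set ℝ}
    {X : ℝ → Fin 2 → ℝ} (h : S.IsMaximalSolution ε I X) {s τ : ℝ} (hsτ : s < τ)
    (hI : Set.Ico s τ ⊆ I) (hτ : τ ∉ I) {K : Set (ℝ × (Fin 2 → ℝ))} (hK : IsCompact K)
    (hKD : ∀ z ∈ K, (z.1, z.2, ε) ∈ S.realDomain) (hX : ∀ t ∈ Set.Ico s τ, (t, X t) ∈ K) :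
    False := by
  obtain ⟨hne, hopen, hord, hsol⟩ := (S.isSolution_iff hε).1 h.isSolution
  set Ω : Set (ℝ × (Fin 2 → ℝ)) := {z | (z.1, z.2, ε) ∈ S.realDomain} with hΩd
  have hΩ : IsOpen Ω := S.isOpen_realDomain.preimage (by fun_prop)
  obtain ⟨e, he, Y, hXY, hY⟩ := exists_extension (Ω := Ω) hΩ
    (h := fun z => ε⁻¹ • S.realField (z.1, z.2, ε)) (fun z hz => by
      have h0 : ContDiffAt ℝ 1 S.realField (z.1, z.2, ε) := S.contDiffAt_realField hz
      have h1 : ContDiffAt ℝ 1 (fun z : ℝ × (Fin 2 → ℝ) => (z.1, z.2, ε)) z := by fun_prop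
      exact (h0.comp z h1).const_smul ε⁻¹) hK hKD hsτ
    (fun t ht => (hsol t (hI ht)).2) hX
  have hs : s ∈ I := hI ⟨le_rfl, hsτ⟩
  have hlt : ∀ t ∈ I, t < τ := fun t ht => by
    by_contra! hle
    exact hτ (hord.out hs ht ⟨hsτ.le, hle⟩)
  have hJ : S.IsSolution ε (I ∪ Set.Ioo s (τ + e)) Y := by
    refine (S.isSolution_iff hε).2 ⟨hne.inl, hopen.union isOpen_Ioo, ?_, ?_⟩
    · refine (isPreconnected_iff_ordConnected.1 ?_)
      have hmid : (s + τ) / 2 ∈ Set.Ico s τ := ⟨by linarith, by linarith⟩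
      exact IsPreconnected.union ((s + τ) / 2) (hI hmid) ⟨by linarith, by linarith⟩
        hord.isPreconnected isPreconnected_Ioo
    · rintro t (ht | ht)
      · have htτ := hlt t ht
        rw [← hXY htτ]
        refine ⟨(hsol t ht).1, (hsol t ht).2.congr_of_eventuallyEq ?_⟩
        filter_upwards [Iio_mem_nhds htτ] with u hu using (hXY hu).symm
      · exact hY t ht
  have := h.maximal _ Y hJ Set.subset_union_left fun t ht => hXY (hlt t ht)
  exact hτ (this ▸ Or.inr ⟨hsτ, by linarith⟩)

/-- Continuation inside a tube: if closeness to the slow curve improves itself, then a maximal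
solution starting in the tube remains in it. -/
theorem IsMaximalSolution.continuation {S : HFNSystem} {ε : ℝ} (hε : ε ≠ 0) {I : Set ℝ}
    {X : ℝ → Fin 2 → ℝ} (h : S.IsMaximalSolution ε I X) {s T η : ℝ} (hsT : s ≤ T)
    (hD : ∀ t ∈ Set.Icc s T, (t : ℂ) ∈ S.Dt)
    (htube : ∀ t ∈ Set.Icc s T, ∀ x, ‖x - S.realSlow t‖ ≤ η → (t, x, ε) ∈ S.realDomain)
    (hs : s ∈ I) (hXs : ‖X s - S.realSlow s‖ < η)
    (hboot : ∀ t ∈ Set.Icc s T, Set.Icc s t ⊆ I →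
      (∀ u ∈ Set.Icc s t, ‖X u - S.realSlow u‖ ≤ η) → ‖X t - S.realSlow t‖ < η) :
    ∀ t ∈ Set.Icc s T, t ∈ I ∧ ‖X t - S.realSlow t‖ < η := by
  obtain ⟨hne, hopen, hord, hsol⟩ := (S.isSolution_iff hε).1 h.isSolution
  have hψ : ∀ t ∈ Set.Icc s T, ContinuousAt S.realSlow t := fun t ht =>
    (S.contDiffAt_realSlow (n := 0) (hD t ht)).continuousAt
  have hcont : ∀ t ∈ Set.Icc s T, t ∈ I → ContinuousAt (fun t => ‖X t - S.realSlow t‖) t :=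
    fun t ht htI => ((hsol t htI).2.continuousAt.sub (hψ t ht)).norm
  set G : Set ℝ := {t | t ∈ Set.Icc s T ∧ ∀ u ∈ Set.Icc s t, u ∈ I ∧ ‖X u - S.realSlow u‖ < η}
    with hG
  have hsG : s ∈ G := by
    refine ⟨⟨le_rfl, hsT⟩, fun u hu => ?_⟩
    have : u = s := le_antisymm hu.2 hu.1
    exact this ▸ ⟨hs, hXs⟩
  have hbdd : BddAbove G := ⟨T, fun t ht => ht.1.2⟩
  set τ := sSup G with hτ
  have hsτ : s ≤ τ := le_csSup hbdd hsG
  have hτT : τ ≤ T := csSup_le ⟨s, hsG⟩ fun t ht => ht.1.2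
  have hbelow : ∀ t ∈ Set.Ico s τ, t ∈ I ∧ ‖X t - S.realSlow t‖ < η := by
    intro t ht
    obtain ⟨g, hg, htg⟩ := exists_lt_of_lt_csSup ⟨s, hsG⟩ ht.2
    exact hg.2 t ⟨ht.1, htg.le⟩
  have hτI : τ ∈ I := by
    by_contra hnot
    have hlt : s < τ := lt_of_le_of_ne hsτ fun he => hnot (he ▸ hs)
    have hsub : Set.Icc s τ ⊆ Set.Icc s T := Set.Icc_subset_Icc_right hτT
    refine h.not_mem_compact hε hlt (fun t ht => (hbelow t ht).1) hnot
      -- The closed tube over `[s, τ]` is compact, being a continuous image of a product, so the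
      -- solution cannot end at `τ`.
      (K := (fun z : ℝ × (Fin 2 → ℝ) => (z.1, S.realSlow z.1 + z.2)) ''
        (Set.Icc s τ ×ˢ Metric.closedBall 0 η)) ?_ ?_ ?_
    · refine (isCompact_Icc.prod (isCompact_closedBall _ _)).image_of_continuousOn ?_
      intro z hz
      have h1 : ContinuousAt (fun z : ℝ × (Fin 2 → ℝ) => S.realSlow z.1) z :=
        ContinuousAt.comp (f := Prod.fst) (hψ z.1 (hsub hz.1)) continuousAt_fst
      exact (continuousAt_fst.prodMk (h1.add continuousAt_snd)).continuousWithinAt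
    · rintro _ ⟨z, hz, rfl⟩
      refine htube z.1 (hsub hz.1) _ ?_
      simpa using! hz.2
    · intro t ht
      refine ⟨(t, X t - S.realSlow t), ⟨⟨ht.1, ht.2.le⟩, ?_⟩, by simp⟩
      simpa using! (hbelow t ht).2.le
  have hsub : Set.Icc s τ ⊆ I := hord.out hs hτI
  have hτη : ‖X τ - S.realSlow τ‖ < η := by
    rcases hsτ.eq_or_lt with he | hlt
    · exact he ▸ hXs
    -- At `τ` itself continuity gives only the weak inequality; `hboot` makes it strict, so that the
    -- supremum can be exceeded.
    · refine hboot τ ⟨hsτ, hτT⟩ hsub fun u hu => ?_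
      rcases hu.2.eq_or_lt with he | hu'
      · rw [he]
        have hlim : Tendsto (fun t => ‖X t - S.realSlow t‖) (𝓝[<] τ)
            (𝓝 ‖X τ - S.realSlow τ‖) :=
          (hcont τ ⟨hsτ, hτT⟩ hτI).tendsto.mono_left nhdsWithin_le_nhds
        refine le_of_tendsto hlim ?_
        filter_upwards [Ico_mem_nhdsLT hlt] with v hv using (hbelow v hv).2.le
      · exact (hbelow u ⟨hu.1, hu'⟩).2.le
  have hτG : ∀ u ∈ Set.Icc s τ, u ∈ I ∧ ‖X u - S.realSlow u‖ < η := by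
    intro u hu
    rcases hu.2.eq_or_lt with he | hu'
    · exact he ▸ ⟨hτI, hτη⟩
    · exact hbelow u ⟨hu.1, hu'⟩
  have hτeq : τ = T := by
    by_contra hneq
    have hlt : τ < T := lt_of_le_of_ne hτT hneq
    have hev : ∀ᶠ u in 𝓝 τ, u ∈ I ∧ ‖X u - S.realSlow u‖ < η :=
      Filter.Eventually.and (hopen.mem_nhds hτI)
        ((hcont τ ⟨hsτ, hτT⟩ hτI).eventually_lt continuousAt_const hτη)
    obtain ⟨e, he, hball⟩ := Metric.eventually_nhds_iff.1 hev
    have hmem : min (τ + e / 2) T ∈ G := by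
      refine ⟨⟨le_min (by linarith) hsT, min_le_right _ _⟩, fun u hu => ?_⟩
      rcases le_or_gt u τ with hle | hgt
      · exact hτG u ⟨hu.1, hle⟩
      · refine hball ?_
        have := hu.2.trans (min_le_left _ _)
        rw [Real.dist_eq, abs_of_pos (by linarith)]
        linarith
    have h1 := le_csSup hbdd hmem
    have h2 : τ < min (τ + e / 2) T := lt_min (by linarith) hlt
    linarith
  exact hτeq ▸ hτG

end HFNSystem

/-! ### Linearization along the slow curve and transfer of closeness -/

namespace HFNSystem

/-- The Jacobian matrix of the real vector field along the real slow curve. -/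
noncomputable def realJac (S : HFNSystem) (t : ℝ) : Matrix (Fin 2) (Fin 2) ℝ :=
  Matrix.of fun i j => fderiv ℝ S.realField (t, S.realSlow t, 0) (0, Pi.single j 1, 0) i

theorem realJac_mulVec (S : HFNSystem) (t : ℝ) (v : Fin 2 → ℝ) :
    (S.realJac t).mulVec v = fderiv ℝ S.realField (t, S.realSlow t, 0) (0, v, 0) := by
  have hv : ((0 : ℝ), v, (0 : ℝ))
      = v 0 • ((0 : ℝ), (Pi.single 0 1 : Fin 2 → ℝ), (0 : ℝ))
        + v 1 • ((0 : ℝ), (Pi.single 1 1 : Fin 2 → ℝ), (0 : ℝ)) := by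
    ext i
    · simp
    · fin_cases i <;> simp
    · simp
  rw [hv, map_add, map_smul, map_smul]
  ext i
  simp only [Matrix.mulVec, dotProduct, Fin.sum_univ_two, realJac, Matrix.of_apply,
    Pi.add_apply, Pi.smul_apply, smul_eq_mul]
  ring

/-- The slow curve is real on the real axis. -/
def HasRealSlow (S : HFNSystem) : Prop :=
  ∀ t : ℝ, (t : ℂ) ∈ S.Dt → complexify (S.realSlow t) = S.φ t

theorem HasRealSlow.embedding {S : HFNSystem} (hr : S.HasRealSlow) {t : ℝ}
    (ht : (t : ℂ) ∈ S.Dt) : realEmbedding (t, S.realSlow t, 0) = ((t : ℂ), S.φ t, (0 : ℂ)) := by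
  rw [realEmbedding_apply]
  simp [hr t ht]

theorem HasRealSlow.mem {S : HFNSystem} (hr : S.HasRealSlow) {t : ℝ} (ht : (t : ℂ) ∈ S.Dt) :
    (t, S.realSlow t, 0) ∈ S.realDomain := by
  change realEmbedding _ ∈ S.D
  rw [hr.embedding ht]
  exact S.slow_mem _ ht

theorem HasRealSlow.field_eq_zero {S : HFNSystem} (hr : S.HasRealSlow) {t : ℝ}
    (ht : (t : ℂ) ∈ S.Dt) : S.realField (t, S.realSlow t, 0) = 0 := by
  rw [realField, hr.embedding ht, S.slow_eq _ ht, map_zero]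

theorem HasRealSlow.contDiffAt_realJac {S : HFNSystem} (hr : S.HasRealSlow) {t : ℝ}
    (ht : (t : ℂ) ∈ S.Dt) (i j : Fin 2) : ContDiffAt ℝ 1 (fun t => S.realJac t i j) t := by
  have h1 : ContDiffAt ℝ 1 (fderiv ℝ S.realField) (t, S.realSlow t, 0) :=
    (S.contDiffAt_realField (n := 2) (hr.mem ht)).fderiv_right (by norm_num)
  have h2 : ContDiffAt ℝ 1 (fun t => (t, S.realSlow t, (0 : ℝ))) t :=
    contDiffAt_id.prodMk ((S.contDiffAt_realSlow ht).prodMk contDiffAt_const)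
  have h3 : ContDiffAt ℝ 1 (fun t => fderiv ℝ S.realField (t, S.realSlow t, 0)
      (0, Pi.single j 1, 0)) t := (h1.comp t h2).clm_apply contDiffAt_const
  exact contDiffAt_pi.1 h3 i

/-- Compactness makes `η` uniform in `t`. The estimate involves two arbitrary points of the tube
because it is applied to the difference of two solutions. -/
theorem HasRealSlow.exists_tube {S : HFNSystem} (hr : S.HasRealSlow) {K : Set ℝ}
    (hK : IsCompact K) (hKD : ∀ t ∈ K, (t : ℂ) ∈ S.Dt) {ω : ℝ} (hω : 0 < ω) :
    ∃ η > 0, ∀ ε : ℝ, |ε| < η → ∀ t ∈ K, ∀ x, ‖x - S.realSlow t‖ < η →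
      (t, x, ε) ∈ S.realDomain ∧ ∀ x', ‖x' - S.realSlow t‖ < η →
        ‖S.realField (t, x, ε) - S.realField (t, x', ε) - (S.realJac t).mulVec (x - x')‖
          ≤ ω * ‖x - x'‖ := by
  have hψ : ∀ t ∈ K, ContinuousAt S.realSlow t := fun t ht =>
    (S.contDiffAt_realSlow (n := 0) (hKD t ht)).continuousAt
  have h1 := eventually_linearization hK hψ
    (fun t ht => S.contDiffAt_realField (hr.mem (hKD t ht))) hω
  have h2 : ∀ᶠ q : (Fin 2 → ℝ) × (Fin 2 → ℝ) × ℝ in 𝓝 0, ∀ t ∈ K,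
      (t, S.realSlow t + q.1, q.2.2) ∈ S.realDomain := by
    refine hK.eventually_forall_of_forall_eventually
      (P := fun (q : (Fin 2 → ℝ) × (Fin 2 → ℝ) × ℝ) (t : ℝ) =>
        (t, S.realSlow t + q.1, q.2.2) ∈ S.realDomain) fun t ht => ?_
    have hc1 : ContinuousAt (fun z : ((Fin 2 → ℝ) × (Fin 2 → ℝ) × ℝ) × ℝ => S.realSlow z.2)
        (0, t) := ContinuousAt.comp (g := S.realSlow)
        (f := fun z : ((Fin 2 → ℝ) × (Fin 2 → ℝ) × ℝ) × ℝ => z.2) (hψ t ht) continuousAt_snd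
    have hc : ContinuousAt (fun z : ((Fin 2 → ℝ) × (Fin 2 → ℝ) × ℝ) × ℝ =>
        (z.2, S.realSlow z.2 + z.1.1, z.1.2.2)) (0, t) := by fun_prop
    refine hc.eventually_mem (S.isOpen_realDomain.mem_nhds ?_)
    simpa using! hr.mem (hKD t ht)
  obtain ⟨η, hη, hball⟩ := Metric.eventually_nhds_iff.1 (h1.and h2)
  have hq : ∀ (u u' : Fin 2 → ℝ) (ε : ℝ), ‖u‖ < η → ‖u'‖ < η → |ε| < η →
      dist ((u, u', ε) : (Fin 2 → ℝ) × (Fin 2 → ℝ) × ℝ) 0 < η := by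
    intro u u' ε hu hu' hε
    rw [dist_zero_right, Prod.norm_def, Prod.norm_def]
    exact max_lt hu (max_lt hu' hε)
  refine ⟨η, hη, fun ε hε t ht x hx => ⟨?_, fun x' hx' => ?_⟩⟩
  · simpa using (hball (hq _ 0 ε hx (by simpa using hη) hε)).2 t ht
  · have := (hball (hq _ _ ε hx hx' hε)).1 t ht
    rw [realJac_mulVec]
    simpa using this

namespace Trajectory

/-- Uniform closeness to the real slow curve on `[p, q]`. -/
def CloseOn {S : HFNSystem} {l : Filter ℝ} (T : S.Trajectory l) (p q : ℝ) : Prop :=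
  ∀ η > 0, ∀ᶠ ε in l, ∀ t ∈ Set.Icc p q, t ∈ T.I ε ∧ ‖T.X ε t - S.realSlow t‖ < η

/-- Closeness is transferred from `[p, m]` to `[m, q]` by comparison with approximate solutions
`Z ε` close to the slow curve, as long as the growth rate, integrated from `p`, is nonpositive. -/
theorem CloseOn.transfer {S : HFNSystem} (hr : S.HasRealSlow) {l : Filter ℝ}
    (hl : l ≤ 𝓝[>] (0 : ℝ)) {T : S.Trajectory l} {p m q δ : ℝ} (hpm : p ≤ m) (hmq : m ≤ q)
    (hD : ∀ t ∈ Set.Icc p q, (t : ℂ) ∈ S.Dt) (hδ : 0 < δ)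
    (hd : ∀ t ∈ Set.Icc p q, ((S.realJac t 0 0 - S.realJac t 1 1) / 2) ^ 2
      + S.realJac t 0 1 * S.realJac t 1 0 ≤ δ ^ 2 / 2)
    {K K' : ℝ → ℝ} (hK : ∀ t ∈ Set.Icc p q, HasDerivAt K (K' t) t)
    (hK' : ∀ t ∈ Set.Icc p q, S.realJac t 0 0 + S.realJac t 1 1 + 4 * δ ≤ K' t)
    (hKle : ∀ t ∈ Set.Icc m q, K t ≤ K p) (hT : T.CloseOn p m)
    {Z Z' : ℝ → ℝ → Fin 2 → ℝ}
    (hZ : ∀ η > 0, ∀ᶠ ε in l, ∀ t ∈ Set.Icc p q, ‖Z ε t - S.realSlow t‖ < η)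
    (hZd : ∀ᶠ ε in l, ∀ t ∈ Set.Icc p q, HasDerivAt (Z ε) (Z' ε t) t)
    (hZf : (∀ᶠ ε in l, ∀ t ∈ Set.Icc p q,
        ‖ε • Z' ε t - S.realField (t, Z ε t, ε)‖ ≤ 0) ∨
      (∃ c > 0, ∀ t ∈ Set.Icc p q, K' t ≤ -c) ∧ ∀ r > 0, ∀ᶠ ε in l, ∀ t ∈ Set.Icc p q,
        ‖ε • Z' ε t - S.realField (t, Z ε t, ε)‖ ≤ r) :
    T.CloseOn m q := by
  obtain ⟨W, c, hc, C, hC, hW, hdW⟩ := exists_lyapunov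
    (fun t ht i j => hr.contDiffAt_realJac (hD t ht) i j) hδ hd
  -- With this `ω` and `ε < δ / (2 * C)`, the error `C * (ε + ω)` is at most `δ`, raising `3 * δ` to
  -- the `4 * δ` allowed by `hK'`.
  obtain ⟨η0, hη0, htube⟩ := hr.exists_tube isCompact_Icc hD (ω := δ / (2 * C)) (by positivity)
  intro η hη
  set η1 := min η (η0 / 2) with hη1d
  have hη1 : 0 < η1 := lt_min hη (by positivity)
  have hη10 : η1 < η0 := (min_le_right _ _).trans_lt (by linarith)
  -- An initial distance of at most `2 * θ * η1` gives `W ≤ c * η1 ^ 2 / 8` at `p`. The residual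
  -- contributes less than another `c * η1 ^ 2 / 8`, and the sum corresponds to a distance below `η1
  -- / 2`.
  set θ := min (1 / 2) (c / (32 * C)) with hθd
  have hθ : 0 < θ := lt_min (by norm_num) (by positivity)
  have hθ1 : θ ≤ 1 / 2 := min_le_left _ _
  have hθ2 : 4 * θ ^ 2 * C ≤ c / 8 := by
    have h1 : θ ≤ c / (32 * C) := min_le_right _ _
    rw [le_div_iff₀ (by positivity)] at h1
    nlinarith [mul_pos hθ hC]
  have hsmall : ∀ᶠ ε in l, 0 < ε ∧ ε < η0 ∧ ε < δ / (2 * C) := by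
    have h0 : ∀ᶠ ε : ℝ in 𝓝[>] 0, 0 < ε ∧ ε < η0 ∧ ε < δ / (2 * C) := by
      filter_upwards [Ioo_mem_nhdsGT hη0,
        Ioo_mem_nhdsGT (show (0 : ℝ) < δ / (2 * C) by positivity)] with ε h1 h2
      exact ⟨h1.1, h1.2, h2.2⟩
    exact hl h0
  -- The level `B * r ^ 2` absorbs the forcing: `W - B * r ^ 2` satisfies a homogeneous differential
  -- inequality. An exact solution `Z` needs only level zero; otherwise `K' ≤ -c0` makes `B = C /
  -- c0` suffice.
  obtain ⟨B, hB0, r, hr0, hBr, hB, hZr⟩ : ∃ B ≥ 0, ∃ r ≥ 0, B * r ^ 2 < c * η1 ^ 2 / 8 ∧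
      (∀ t ∈ Set.Icc p q, C * r ^ 2 ≤ -K' t * (B * r ^ 2)) ∧ ∀ᶠ ε in l, ∀ t ∈ Set.Icc p q,
        ‖ε • Z' ε t - S.realField (t, Z ε t, ε)‖ ≤ r := by
    rcases hZf with h | ⟨⟨c0, hc0, h⟩, hf⟩
    · exact ⟨0, le_rfl, 0, le_rfl, by rw [zero_mul]; positivity, fun t _ => by simp, h⟩
    · have hlim : Tendsto (fun r : ℝ => C / c0 * r ^ 2) (𝓝[>] 0) (𝓝 0) := by
        have h0 : Continuous fun r : ℝ => C / c0 * r ^ 2 := by fun_prop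
        simpa using h0.continuousAt.tendsto.mono_left (nhdsWithin_le_nhds (a := (0 : ℝ)))
      obtain ⟨r, hr1, hr0⟩ := ((hlim.eventually_lt_const
        (show 0 < c * η1 ^ 2 / 8 by positivity)).and self_mem_nhdsWithin).exists
      refine ⟨C / c0, by positivity, r, le_of_lt hr0, hr1, fun t ht => ?_, hf r hr0⟩
      calc C * r ^ 2 = c0 * (C / c0 * r ^ 2) := by field_simp
        _ ≤ _ := by gcongr; linarith [h t ht]
  filter_upwards [hsmall, hZr, hZ (θ * η1) (by positivity), hT (θ * η1) (by positivity),
    hZd, T.isMaximal] with ε ⟨hε, hε1, hε2⟩ hZrε hZε hTε hZdε hmax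
  obtain ⟨hne, hopen, hord, hsol⟩ := (S.isSolution_iff hε.ne').1 hmax.isSolution
  have habs : |ε| < η0 := by rwa [abs_of_pos hε]
  have hsubm : Set.Icc m q ⊆ Set.Icc p q := Set.Icc_subset_Icc_left hpm
  have hθη : θ * η1 ≤ η1 / 2 := by nlinarith
  have hmI := hTε m ⟨hpm, le_rfl⟩
  have hmain := hmax.continuation hε.ne' hmq (fun t ht => hD t (hsubm ht)) (η := η1)
    (fun t ht x hx => (htube ε habs t (hsubm ht) x (hx.trans_lt hη10)).1) hmI.1
    (hmI.2.trans_le (by linarith)) ?_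
  · exact fun t ht => ⟨(hmain t ht).1, (hmain t ht).2.trans_le (min_le_left _ _)⟩
  intro t ht hI hX
  have hpt : p ≤ t := hpm.trans ht.1
  have hall : ∀ u ∈ Set.Icc p t, u ∈ T.I ε ∧ ‖T.X ε u - S.realSlow u‖ ≤ η1 := by
    intro u hu
    rcases le_total u m with h | h
    · have := hTε u ⟨hu.1, h⟩
      exact ⟨this.1, this.2.le.trans (by linarith)⟩
    · exact ⟨hI ⟨h, hu.2⟩, hX u ⟨h, hu.2⟩⟩
  have hsub : Set.Icc p t ⊆ Set.Icc p q := Set.Icc_subset_Icc_right ht.2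
  have hWex : ∀ u ∈ Set.Icc p t, ∃ W',
      HasDerivAt (fun u => W u (T.X ε u - Z ε u)) W' u ∧
      ε * W' ≤ K' u * (W u (T.X ε u - Z ε u) - B * r ^ 2) := by
    intro u hu
    obtain ⟨huI, huX⟩ := hall u hu
    have hu' := hsub hu
    have huZ := hZε u hu'
    have hZ1 := hZdε u hu'
    have hZ2 := hZrε u hu'
    have hlin := (htube ε habs u hu' _ (huX.trans_lt hη10)).2 (Z ε u) (by linarith)
    obtain ⟨W', hW'1, hW'2⟩ := hdW ε (δ / (2 * C)) r hε (by positivity) hr0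
      (fun u => T.X ε u - Z ε u) _ u hu' ((hsol u huI).2.sub hZ1) (by
        rw [smul_sub, smul_inv_smul₀ hε.ne']
        calc _ = ‖(S.realField (u, T.X ε u, ε) - S.realField (u, Z ε u, ε)
                - (S.realJac u).mulVec (T.X ε u - Z ε u))
                - (ε • Z' ε u - S.realField (u, Z ε u, ε))‖ := by congr 1; abel
          _ ≤ _ := (norm_sub_le _ _).trans (add_le_add hlin hZ2))
    refine ⟨W', hW'1, hW'2.trans ?_⟩
    have hWpos : 0 ≤ W u (T.X ε u - Z ε u) :=
      le_trans (by positivity) (hW u hu' _).1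
    have hrate : S.realJac u 0 0 + S.realJac u 1 1 + 3 * δ + C * (ε + δ / (2 * C)) ≤ K' u := by
      refine le_trans ?_ (hK' u hu')
      have h1 : C * ε ≤ C * (δ / (2 * C)) := by gcongr
      have h2 : C * (δ / (2 * C)) = δ / 2 := by field_simp
      rw [mul_add]
      linarith
    have h3 := mul_le_mul_of_nonneg_right hrate hWpos
    have h4 := hB u hu'
    linarith
  choose! W' hW'1 hW'2 using hWex
  have hgron := le_mul_exp_of_hasDerivAt_le hpt
    (fun u hu => (hW'1 u hu).sub_const (B * r ^ 2))
    (fun u hu => (hK u (hsub hu)).div_const ε) (fun u hu => by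
      rw [div_mul_eq_mul_div, le_div_iff₀ hε, mul_comm]
      exact hW'2 u hu)
  have hexp : Real.exp (K t / ε - K p / ε) ≤ 1 := by
    rw [Real.exp_le_one_iff, ← sub_div]
    exact div_nonpos_of_nonpos_of_nonneg (by linarith [hKle t ht]) hε.le
  have hBr0 : 0 ≤ B * r ^ 2 := by positivity
  have hWp0 : 0 ≤ W p (T.X ε p - Z ε p) :=
    le_trans (by positivity) (hW p (hsub ⟨le_rfl, hpt⟩) _).1
  have hWt : W t (T.X ε t - Z ε t) ≤ W p (T.X ε p - Z ε p) + B * r ^ 2 := by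
    have e0 := Real.exp_pos (K t / ε - K p / ε)
    nlinarith
  have hdist : ‖T.X ε p - Z ε p‖ ≤ 2 * (θ * η1) := by
    have h1 := (hTε p ⟨le_rfl, hpm⟩).2
    have h2 := hZε p (hsub ⟨le_rfl, hpt⟩)
    calc ‖T.X ε p - Z ε p‖ = ‖(T.X ε p - S.realSlow p) - (Z ε p - S.realSlow p)‖ := by
          congr 1; abel
      _ ≤ _ := (norm_sub_le _ _).trans (by linarith)
  have hWp : W p (T.X ε p - Z ε p) ≤ c * η1 ^ 2 / 8 := by
    calc _ ≤ C * ‖T.X ε p - Z ε p‖ ^ 2 := (hW p (hsub ⟨le_rfl, hpt⟩) _).2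
      _ ≤ C * (2 * (θ * η1)) ^ 2 := by gcongr
      _ = 4 * θ ^ 2 * C * η1 ^ 2 := by ring
      _ ≤ c / 8 * η1 ^ 2 := by gcongr
      _ = _ := by ring
  have hfin : c * ‖T.X ε t - Z ε t‖ ^ 2 < c * (η1 / 2) ^ 2 := by
    have := (hW t (hsub ⟨hpt, le_rfl⟩) (T.X ε t - Z ε t)).1
    nlinarith
  have hfin2 : ‖T.X ε t - Z ε t‖ < η1 / 2 :=
    lt_of_pow_lt_pow_left₀ 2 (by positivity) (lt_of_mul_lt_mul_left hfin hc.le)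
  have hZt := hZε t (hsub ⟨hpt, le_rfl⟩)
  calc ‖T.X ε t - S.realSlow t‖ = ‖(T.X ε t - Z ε t) + (Z ε t - S.realSlow t)‖ := by
        congr 1; abel
    _ < η1 := (norm_add_le _ _).trans_lt (by linarith)

end Trajectory

end HFNSystem

/-! ### Reality of the slow curve, eigenvalues and the relief -/

namespace HFNSystem

theorem ordConnected_realTrace (S : HFNSystem) : Set.OrdConnected {t : ℝ | (t : ℂ) ∈ S.Dt} := by
  refine ⟨fun x hx y hy z hz => ?_⟩
  have h1 := (S.real_trace x).1 hx
  have h2 := (S.real_trace y).1 hy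
  refine (S.real_trace z).2 ⟨h1.1.trans_le ?_, lt_of_le_of_lt ?_ h2.2⟩
  · exact_mod_cast hz.1
  · exact_mod_cast hz.2

theorem isOpen_realTrace (S : HFNSystem) : IsOpen {t : ℝ | (t : ℂ) ∈ S.Dt} :=
  S.isOpen_Dt.preimage Complex.continuous_ofReal

theorem b_mem (S : HFNSystem) : (S.b : ℂ) ∈ S.Dt :=
  (S.real_trace S.b).2
    ⟨S.tm_lt_a.trans (by exact_mod_cast S.a_lt_b), S.b_lt_tM⟩

theorem a_mem (S : HFNSystem) : (S.a : ℂ) ∈ S.Dt :=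
  (S.real_trace S.a).2
    ⟨S.tm_lt_a, lt_trans (by exact_mod_cast S.a_lt_b) S.b_lt_tM⟩

/-- If some trajectory goes along the slow curve somewhere, then the slow curve is real. -/
theorem hasRealSlow_of_goesAlong {S : HFNSystem} {l : Filter ℝ} [l.NeBot] {T : S.Trajectory l}
    {t₁ t₂ : ℝ} (h12 : t₁ < t₂) (h : T.GoesAlong t₁ t₂) : S.HasRealSlow := by
  intro t ht
  ext i
  have hloc : ∀ u ∈ Set.Ioo t₁ t₂, (S.φ u i).im = 0 := by
    intro u hu
    by_contra hne
    obtain ⟨ε, hε⟩ := (h.2 u u hu.1 hu.2 |(S.φ u i).im| (abs_pos.2 hne)).exists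
    have h1 := (hε u ⟨le_rfl, le_rfl⟩).2
    have h2 := norm_le_pi_norm (complexify (T.X ε u) - S.φ u) i
    have h3 := Complex.abs_im_le_norm ((complexify (T.X ε u) - S.φ u) i)
    simp only [Pi.sub_apply, complexify, Complex.sub_im, Complex.ofReal_im, zero_sub,
      abs_neg] at h3
    exact absurd h1 (not_lt.2 (h3.trans h2))
  -- Limits of real solutions are real, so `Im φ` vanishes on `]t₁, t₂[`; analyticity spreads this
  -- to the whole real trace, which is an interval.
  have han : AnalyticOnNhd ℝ (fun u : ℝ => (S.φ u i).im) {t : ℝ | (t : ℂ) ∈ S.Dt} := by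
    intro u hu
    have h1 : AnalyticAt ℝ S.φ (Complex.ofRealCLM u) :=
      (S.analytic_φ _ hu).restrictScalars (𝕜 := ℝ)
    have h2 : AnalyticAt ℝ (fun u : ℝ => S.φ u) u :=
      h1.comp (Complex.ofRealCLM.analyticAt u)
    have h3 : AnalyticAt ℝ (fun z : Fin 2 → ℂ => (z i).im) (S.φ u) :=
      (Complex.imCLM.comp (ContinuousLinearMap.proj (R := ℝ) (φ := fun _ : Fin 2 => ℂ) i)).analyticAt
        (S.φ u)
    exact AnalyticAt.comp (g := fun z : Fin 2 → ℂ => (z i).im) (f := fun u : ℝ => S.φ u) h3 h2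
  have hmid : (t₁ + t₂) / 2 ∈ Set.Ioo t₁ t₂ := ⟨by linarith, by linarith⟩
  have hzero := han.eqOn_zero_of_preconnected_of_eventuallyEq_zero
    S.ordConnected_realTrace.isPreconnected (h.1 _ hmid)
    (by filter_upwards [Ioo_mem_nhds hmid.1 hmid.2] with u hu using hloc u hu) ht
  exact Complex.ext rfl hzero.symm

namespace Trajectory

theorem GoesAlong.closeOn {S : HFNSystem} (hr : S.HasRealSlow) {l : Filter ℝ}
    {T : S.Trajectory l} {t₁ t₂ : ℝ} (h : T.GoesAlong t₁ t₂) {p q : ℝ} (hp : t₁ < p)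
    (hq : q < t₂) : T.CloseOn p q := by
  intro η hη
  filter_upwards [h.2 p q hp hq η hη] with ε hε t ht
  refine ⟨(hε t ht).1, ?_⟩
  rw [← norm_complexify, ← complexify_sub,
    hr t (h.1 t ⟨hp.trans_le ht.1, ht.2.trans_lt hq⟩)]
  exact (hε t ht).2

theorem CloseOn.mono {S : HFNSystem} {l : Filter ℝ} {T : S.Trajectory l} {p q p' q' : ℝ}
    (h : T.CloseOn p q) (hp : p ≤ p') (hq : q' ≤ q) : T.CloseOn p' q' := fun η hη =>
  (h η hη).mono fun _ hε t ht => hε t ⟨hp.trans ht.1, ht.2.trans hq⟩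

theorem CloseOn.goesAlong {S : HFNSystem} (hr : S.HasRealSlow) {l : Filter ℝ}
    {T : S.Trajectory l} {t₁ t₂ : ℝ} (hD : ∀ t ∈ Set.Ioo t₁ t₂, (t : ℂ) ∈ S.Dt)
    (h : ∀ p q, t₁ < p → q < t₂ → T.CloseOn p q) : T.GoesAlong t₁ t₂ := by
  refine ⟨hD, fun p q hp hq η hη => ?_⟩
  filter_upwards [h p q hp hq η hη] with ε hε t ht
  refine ⟨(hε t ht).1, ?_⟩
  rw [← hr t (hD t ⟨hp.trans_le ht.1, ht.2.trans_lt hq⟩), complexify_sub, norm_complexify]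
  exact (hε t ht).2

end Trajectory

/-- The complex Jacobian matrix along the real slow curve is the real one. -/
theorem HasRealSlow.toMatrix'_fderiv {S : HFNSystem} (hr : S.HasRealSlow) {t : ℝ}
    (ht : (t : ℂ) ∈ S.Dt) (i j : Fin 2) :
    LinearMap.toMatrix' (fderiv ℂ (fun x : Fin 2 → ℂ => S.f ((t : ℂ), x, (0 : ℂ)))
      (S.φ t)).toLinearMap i j = (S.realJac t i j : ℂ) := by
  set F : (Fin 2 → ℂ) → (Fin 2 → ℂ) := fun x => S.f ((t : ℂ), x, (0 : ℂ)) with hF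
  have hFd : HasFDerivAt F (fderiv ℂ F (S.φ t)) (S.φ t) := by
    have h1 : DifferentiableAt ℂ S.f ((t : ℂ), S.φ t, (0 : ℂ)) :=
      (S.analytic_f _ (S.slow_mem _ ht)).differentiableAt
    have h2 : DifferentiableAt ℂ (fun x : Fin 2 → ℂ => ((t : ℂ), x, (0 : ℂ))) (S.φ t) := by
      fun_prop
    exact (DifferentiableAt.comp (S.φ t) h1 h2).hasFDerivAt
  have hGd : HasFDerivAt (fun x : Fin 2 → ℝ => S.realField (t, x, 0))
      ((fderiv ℝ S.realField (t, S.realSlow t, 0)).comp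
        ((ContinuousLinearMap.inr ℝ ℝ ((Fin 2 → ℝ) × ℝ)).comp
          (ContinuousLinearMap.inl ℝ (Fin 2 → ℝ) ℝ))) (S.realSlow t) := by
    have h1 := ((S.contDiffAt_realField (n := 1) (hr.mem ht)).differentiableAt
      one_ne_zero).hasFDerivAt
    have h2 : HasFDerivAt (fun x : Fin 2 → ℝ => (t, x, (0 : ℝ)))
        ((ContinuousLinearMap.inr ℝ ℝ ((Fin 2 → ℝ) × ℝ)).comp
          (ContinuousLinearMap.inl ℝ (Fin 2 → ℝ) ℝ)) (S.realSlow t) :=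
      ((hasFDerivAt_const t _).prodMk
        ((hasFDerivAt_id _).prodMk (hasFDerivAt_const (0 : ℝ) _))).congr_fderiv (by ext <;> simp)
    exact HasFDerivAt.comp (S.realSlow t) h1 h2
  have hleft := complexifyCLM.hasFDerivAt.comp (S.realSlow t) hGd
  have hright : HasFDerivAt (fun x : Fin 2 → ℝ => F (complexifyCLM x))
      (((fderiv ℂ F (S.φ t)).restrictScalars ℝ).comp complexifyCLM) (S.realSlow t) := by
    have h1 : HasFDerivAt F ((fderiv ℂ F (S.φ t)).restrictScalars ℝ)
        (complexifyCLM (S.realSlow t)) := by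
      rw [complexifyCLM_apply, hr t ht]
      exact hFd.restrictScalars ℝ
    exact h1.comp (S.realSlow t) complexifyCLM.hasFDerivAt
  have heq : (fun x : Fin 2 → ℝ => F (complexifyCLM x)) =ᶠ[𝓝 (S.realSlow t)]
      (complexifyCLM ∘ fun x : Fin 2 → ℝ => S.realField (t, x, 0)) := by
    have hc : ContinuousAt (fun x : Fin 2 → ℝ => (t, x, (0 : ℝ))) (S.realSlow t) := by fun_prop
    filter_upwards [hc.eventually_mem (S.isOpen_realDomain.mem_nhds (hr.mem ht))] with x hx
    have := S.complexify_realField hx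
    rw [realEmbedding_apply] at this
    simpa [hF, complexifyCLM_apply] using this.symm
  -- Both sides are real derivatives of the same map, the real field viewed in `ℂ²`.
  have huniq := hright.unique (hleft.congr_of_eventuallyEq heq)
  have hv := congrArg (fun L => L (Pi.single j 1) i) huniq
  have hsingle : complexifyCLM (Pi.single j 1) = Pi.single j 1 := by
    ext k
    rw [complexifyCLM_apply]
    by_cases hk : k = j
    · subst hk; simp [complexify]
    · simp [complexify, hk]
  simp only [ContinuousLinearMap.comp_apply, ContinuousLinearMap.coe_restrictScalars',
    hsingle] at hv
  rw [LinearMap.toMatrix'_apply]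
  simpa [complexifyCLM_apply, complexify, realJac, Pi.single_apply] using! hv

theorem HasRealSlow.eigenvalue_relations {S : HFNSystem} (hr : S.HasRealSlow) {t : ℝ}
    (ht : (t : ℂ) ∈ S.Dt) :
    S.lam t + S.mu t = ((S.realJac t 0 0 + S.realJac t 1 1 : ℝ) : ℂ) ∧
    S.lam t * S.mu t = ((S.realJac t 0 0 * S.realJac t 1 1
      - S.realJac t 0 1 * S.realJac t 1 0 : ℝ) : ℂ) := by
  have h := S.eigenvalues t ht
  rw [Matrix.charpoly_fin_two, Matrix.trace_fin_two, Matrix.det_fin_two] at h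
  simp only [hr.toMatrix'_fderiv ht] at h
  have h0 := congrArg (Polynomial.eval 0) h
  have h1 := congrArg (Polynomial.eval 1) h
  simp at h0 h1
  push_cast
  constructor
  · linear_combination h1 - h0
  · linear_combination -h0

/-- Up to the focus-node point the discriminant is nonpositive and the trace is `2 Re λ`. -/
theorem HasRealSlow.focus {S : HFNSystem} (hr : S.HasRealSlow) {t : ℝ}
    (ht : (t : ℂ) ∈ S.Dt) (htb : t ≤ S.b) :
    2 * (S.lam t).re = S.realJac t 0 0 + S.realJac t 1 1 ∧
    ((S.realJac t 0 0 - S.realJac t 1 1) / 2) ^ 2 + S.realJac t 0 1 * S.realJac t 1 0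
      = -(S.lam t).im ^ 2 ∧ (S.lam t).im ≤ 0 := by
  obtain ⟨h1, h2⟩ := hr.eigenvalue_relations ht
  have h1r := congrArg Complex.re h1
  have h1i := congrArg Complex.im h1
  have h2r := congrArg Complex.re h2
  have h2i := congrArg Complex.im h2
  simp only [Complex.add_re, Complex.add_im, Complex.mul_re, Complex.mul_im,
    Complex.ofReal_re, Complex.ofReal_im] at h1r h1i h2r h2i
  have key : (S.lam t).re = (S.mu t).re ∧ (S.lam t).im ≤ 0 := by
    rcases htb.eq_or_lt with he | hlt
    · rw [he]
      exact ⟨congrArg Complex.re S.eq_at_b, (S.im_node S.b S.b_mem le_rfl).1.le⟩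
    · obtain ⟨hl, hm⟩ := S.im_focus t ht hlt
      refine ⟨?_, hl.le⟩
      -- Trace and determinant are real: `Im μ = -Im λ` turns `Im (λμ) = 0` into this product.
      have hmul : (S.mu t).im * ((S.lam t).re - (S.mu t).re) = 0 := by
        linear_combination h2i - (S.mu t).re * h1i
      rcases mul_eq_zero.1 hmul with h | h
      · exact absurd h hm.ne'
      · linarith
  obtain ⟨hre, him⟩ := key
  have hmi : (S.mu t).im = -(S.lam t).im := by linarith
  rw [hmi] at h2r
  rw [← hre] at h1r h2r
  refine ⟨by linarith, ?_, him⟩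
  have : ((S.realJac t 0 0 - S.realJac t 1 1) / 2) ^ 2 + S.realJac t 0 1 * S.realJac t 1 0
      = ((S.realJac t 0 0 + S.realJac t 1 1) / 2) ^ 2 - (S.realJac t 0 0 * S.realJac t 1 1
      - S.realJac t 0 1 * S.realJac t 1 0) := by ring
  rw [this, ← h1r, ← h2r]
  ring

/-- The trace of the Jacobian matrix along the real slow curve. -/
noncomputable def realTrace (S : HFNSystem) (t : ℝ) : ℝ := S.realJac t 0 0 + S.realJac t 1 1

/-- The discriminant (up to a factor) of the Jacobian matrix along the real slow curve. -/
noncomputable def realDisc (S : HFNSystem) (t : ℝ) : ℝ :=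
  ((S.realJac t 0 0 - S.realJac t 1 1) / 2) ^ 2 + S.realJac t 0 1 * S.realJac t 1 0

theorem HasRealSlow.continuousAt_realTrace {S : HFNSystem} (hr : S.HasRealSlow) {t : ℝ}
    (ht : (t : ℂ) ∈ S.Dt) : ContinuousAt S.realTrace t :=
  (hr.contDiffAt_realJac ht 0 0).continuousAt.add (hr.contDiffAt_realJac ht 1 1).continuousAt

theorem HasRealSlow.continuousAt_realDisc {S : HFNSystem} (hr : S.HasRealSlow) {t : ℝ}
    (ht : (t : ℂ) ∈ S.Dt) : ContinuousAt S.realDisc t :=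
  ((((hr.contDiffAt_realJac ht 0 0).continuousAt.sub
    (hr.contDiffAt_realJac ht 1 1).continuousAt).div_const 2).pow 2).add
    ((hr.contDiffAt_realJac ht 0 1).continuousAt.mul (hr.contDiffAt_realJac ht 1 0).continuousAt)

theorem HasRealSlow.realDisc_nonpos {S : HFNSystem} (hr : S.HasRealSlow) {t : ℝ}
    (ht : (t : ℂ) ∈ S.Dt) (htb : t ≤ S.b) : S.realDisc t ≤ 0 := by
  rw [realDisc, (hr.focus ht htb).2.1]
  nlinarith [sq_nonneg (S.lam t).im]

theorem HasRealSlow.realTrace_eq {S : HFNSystem} (hr : S.HasRealSlow) {t : ℝ}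
    (ht : (t : ℂ) ∈ S.Dt) : S.realTrace t = (S.lam t).re + (S.mu t).re := by
  have := congrArg Complex.re (hr.eigenvalue_relations ht).1
  simpa [realTrace] using this.symm

/-- The integrated trace, which is twice the relief up to the focus-node point. -/
noncomputable def traceIntegral (S : HFNSystem) (t : ℝ) : ℝ := ∫ τ in S.a..t, S.realTrace τ

theorem uIcc_a_subset (S : HFNSystem) {t : ℝ} (ht : (t : ℂ) ∈ S.Dt) :
    Set.uIcc S.a t ⊆ {t : ℝ | (t : ℂ) ∈ S.Dt} :=
  S.ordConnected_realTrace.uIcc_subset S.a_mem ht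

theorem HasRealSlow.hasDerivAt_traceIntegral {S : HFNSystem} (hr : S.HasRealSlow) {t : ℝ}
    (ht : (t : ℂ) ∈ S.Dt) : HasDerivAt S.traceIntegral (S.realTrace t) t := by
  have hcont : ContinuousOn S.realTrace {t : ℝ | (t : ℂ) ∈ S.Dt} := fun u hu =>
    (hr.continuousAt_realTrace hu).continuousWithinAt
  exact intervalIntegral.integral_hasDerivAt_right
    ((hcont.mono (S.uIcc_a_subset ht)).intervalIntegrable)
    (hcont.stronglyMeasurableAtFilter S.isOpen_realTrace t ht) (hr.continuousAt_realTrace ht)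

/-- The real part may be taken inside the integral once `lam` is known to be integrable. Its
continuity is not assumed; it follows from expressing `lam` through the trace and the discriminant,
the choice of root being fixed by `Im λ ≤ 0`. -/
theorem HasRealSlow.two_mul_R {S : HFNSystem} (hr : S.HasRealSlow) {t : ℝ}
    (ht : (t : ℂ) ∈ S.Dt) (htb : t ≤ S.b) : 2 * S.R t = S.traceIntegral t := by
  have hle : ∀ u ∈ Set.uIcc S.a t, u ≤ S.b := fun u hu =>
    hu.2.trans (max_le S.a_lt_b.le htb)
  have hform : ∀ u ∈ Set.uIcc S.a t, S.lam u =
      ((S.realTrace u / 2 : ℝ) : ℂ) - ((Real.sqrt (-S.realDisc u) : ℝ) : ℂ) * Complex.I := by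
    intro u hu
    obtain ⟨h1, h2, h3⟩ := hr.focus (S.uIcc_a_subset ht hu) (hle u hu)
    have h4 : Real.sqrt (-S.realDisc u) = -(S.lam u).im := by
      rw [realDisc, h2, neg_neg, Real.sqrt_sq_eq_abs, abs_of_nonpos h3]
    apply Complex.ext
    · simp [realTrace, ← h1]
    · simp [h4]
  have hcont : ContinuousOn S.lam (Set.uIcc S.a t) := by
    refine ContinuousOn.congr (fun u hu => ContinuousAt.continuousWithinAt ?_) hform
    have h1 := hr.continuousAt_realTrace (S.uIcc_a_subset ht hu)
    have h2 := (hr.continuousAt_realDisc (S.uIcc_a_subset ht hu)).neg.sqrt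
    have h3 : ContinuousAt (fun u => ((S.realTrace u / 2 : ℝ) : ℂ)) u :=
      Complex.continuous_ofReal.continuousAt.comp (h1.div_const 2)
    have h4 : ContinuousAt (fun u => ((Real.sqrt (-S.realDisc u) : ℝ) : ℂ)) u :=
      Complex.continuous_ofReal.continuousAt.comp h2
    exact h3.sub (h4.mul continuousAt_const)
  have hre := Complex.reCLM.intervalIntegral_comp_comm
    (hcont.intervalIntegrable (μ := MeasureTheory.volume))
  rw [R, traceIntegral, ← Complex.reCLM_apply, ← hre, ← intervalIntegral.integral_const_mul]
  refine intervalIntegral.integral_congr fun u hu => ?_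
  exact (hr.focus (S.uIcc_a_subset ht hu) (hle u hu)).1

theorem HasRealSlow.traceIntegral_strictAntiOn {S : HFNSystem} (hr : S.HasRealSlow) :
    StrictAntiOn S.traceIntegral ({t : ℝ | (t : ℂ) ∈ S.Dt} ∩ Set.Iic S.a) := by
  refine strictAntiOn_of_deriv_neg (S.ordConnected_realTrace.inter Set.ordConnected_Iic).convex
    (fun t ht => (hr.hasDerivAt_traceIntegral ht.1).continuousAt.continuousWithinAt) ?_
  intro t ht
  rw [interior_inter, interior_Iic] at ht
  have htD := interior_subset ht.1
  rw [(hr.hasDerivAt_traceIntegral htD).deriv, hr.realTrace_eq htD]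
  have := S.re_neg t htD ht.2
  linarith

theorem HasRealSlow.traceIntegral_monotoneOn {S : HFNSystem} (hr : S.HasRealSlow) :
    MonotoneOn S.traceIntegral ({t : ℝ | (t : ℂ) ∈ S.Dt} ∩ Set.Ici S.a) := by
  refine monotoneOn_of_deriv_nonneg
    (S.ordConnected_realTrace.inter Set.ordConnected_Ici).convex
    (fun t ht => (hr.hasDerivAt_traceIntegral ht.1).continuousAt.continuousWithinAt)
    (fun t ht => (hr.hasDerivAt_traceIntegral
      (interior_subset ht).1).differentiableAt.differentiableWithinAt) ?_
  intro t ht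
  rw [interior_inter, interior_Ici] at ht
  have htD := interior_subset ht.1
  rw [(hr.hasDerivAt_traceIntegral htD).deriv, hr.realTrace_eq htD]
  have := S.re_pos t htD ht.2
  linarith

end HFNSystem

/-! ### Attraction before `a` and following beyond `b` -/

namespace HFNSystem

/-- The slow curve is an approximate solution, uniformly on compact intervals. -/
theorem HasRealSlow.eventually_residual_le {S : HFNSystem} (hr : S.HasRealSlow) {K : Set ℝ}
    (hK : IsCompact K) (hKD : ∀ t ∈ K, (t : ℂ) ∈ S.Dt) {r : ℝ} (hr0 : 0 < r) :
    ∀ᶠ ε : ℝ in 𝓝 0, ∀ t ∈ K,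
      ‖ε • deriv S.realSlow t - S.realField (t, S.realSlow t, ε)‖ ≤ r := by
  refine hK.eventually_forall_of_forall_eventually (P := fun (ε t : ℝ) =>
    ‖ε • deriv S.realSlow t - S.realField (t, S.realSlow t, ε)‖ ≤ r) fun t ht => ?_
  have h1 : ContinuousAt (deriv S.realSlow) t := by
    have h0 : ContinuousAt (fderiv ℝ S.realSlow) t :=
      ((S.contDiffAt_realSlow (n := 1) (hKD t ht)).fderiv_right (m := 0)
        (by norm_num)).continuousAt
    exact h0.clm_apply continuousAt_const
  have h2 : ContinuousAt (fun z : ℝ × ℝ => deriv S.realSlow z.2) (0, t) :=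
    ContinuousAt.comp (g := deriv S.realSlow) (f := fun z : ℝ × ℝ => z.2) h1 continuousAt_snd
  have h3 : ContinuousAt (fun z : ℝ × ℝ => S.realSlow z.2) (0, t) :=
    ContinuousAt.comp (g := S.realSlow) (f := fun z : ℝ × ℝ => z.2)
      (S.contDiffAt_realSlow (n := 0) (hKD t ht)).continuousAt continuousAt_snd
  have h4 : ContinuousAt (fun z : ℝ × ℝ => S.realField (z.2, S.realSlow z.2, z.1)) (0, t) :=
    ContinuousAt.comp (g := S.realField) (f := fun z : ℝ × ℝ => (z.2, S.realSlow z.2, z.1))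
      (S.contDiffAt_realField (n := 0) (hr.mem (hKD t ht))).continuousAt
      (continuousAt_snd.prodMk (h3.prodMk continuousAt_fst))
  have h5 : ContinuousAt (fun z : ℝ × ℝ =>
      ‖z.1 • deriv S.realSlow z.2 - S.realField (z.2, S.realSlow z.2, z.1)‖) (0, t) :=
    ((continuousAt_fst.smul h2).sub h4).norm
  have h6 := h5.eventually_lt (continuousAt_const (y := r)) (by
    simpa [hr.field_eq_zero (hKD t ht)] using hr0)
  exact h6.mono fun z hz => hz.le

namespace Trajectory

/-- On the attractive part, closeness to the slow curve propagates forward. -/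
theorem CloseOn.attracted {S : HFNSystem} (hr : S.HasRealSlow) {l : Filter ℝ}
    (hl : l ≤ 𝓝[>] (0 : ℝ)) {T : S.Trajectory l} {p q : ℝ} (hpq : p ≤ q)
    (hp : (p : ℂ) ∈ S.Dt) (hqa : q < S.a) (hT : T.CloseOn p p) : T.CloseOn p q := by
  have hD : ∀ t ∈ Set.Icc p q, (t : ℂ) ∈ S.Dt := fun t ht =>
    S.ordConnected_realTrace.out hp S.a_mem ⟨ht.1, ht.2.trans hqa.le⟩
  obtain ⟨t0, ht0, hmax⟩ := isCompact_Icc.exists_isMaxOn (Set.nonempty_Icc.2 hpq)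
    (f := S.realTrace) fun t ht => (hr.continuousAt_realTrace (hD t ht)).continuousWithinAt
  have hneg : S.realTrace t0 < 0 := by
    rw [hr.realTrace_eq (hD t0 ht0)]
    have := S.re_neg t0 (hD t0 ht0) (ht0.2.trans_lt hqa)
    linarith
  -- The trace is at most `-2 * c` on `[p, q]`; with `δ = c / 4` the loss `4 * δ` leaves the rate
  -- `-c`.
  set c := -S.realTrace t0 / 2 with hc
  have hc0 : 0 < c := by rw [hc]; linarith
  refine CloseOn.transfer hr hl le_rfl hpq hD (δ := c / 4) (by positivity) (fun t ht => ?_)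
    (K := fun t => -c * t) (K' := fun _ => -c)
    (fun t _ => by simpa using (hasDerivAt_id t).const_mul (-c)) (fun t ht => ?_)
    (fun t ht => ?_) hT (Z := fun _ => S.realSlow) (Z' := fun _ => deriv S.realSlow)
    (fun η hη => Eventually.of_forall fun ε t _ => by simpa using hη)
    (Eventually.of_forall fun ε t ht =>
      ((S.contDiffAt_realSlow (n := 1) (hD t ht)).differentiableAt one_ne_zero).hasDerivAt)
    (Or.inr ⟨⟨c, hc0, fun _ _ => le_rfl⟩, fun r hr0 =>
      hl.trans nhdsWithin_le_nhds (hr.eventually_residual_le isCompact_Icc hD hr0)⟩)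
  · refine (hr.realDisc_nonpos (hD t ht) ?_).trans (by positivity)
    exact (ht.2.trans hqa.le).trans S.a_lt_b.le
  · have : S.realTrace t ≤ S.realTrace t0 := hmax ht
    change S.realTrace t + 4 * (c / 4) ≤ -c
    linarith
  · have := ht.1
    nlinarith

/-- Exponential comparison of two trajectories beyond the Hopf point. -/
theorem CloseOn.follow {S : HFNSystem} (hr : S.HasRealSlow) {l : Filter ℝ}
    (hl : l ≤ 𝓝[>] (0 : ℝ)) {T T' : S.Trajectory l} {s t₂ : ℝ} (hs : (s : ℂ) ∈ S.Dt)
    (hsa : s < S.a) (hRs : S.R S.b < S.R s) (hb : S.b < t₂)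
    (hD : ∀ t ∈ Set.Ico s t₂, (t : ℂ) ∈ S.Dt)
    (hT : ∀ q, q < S.a → T.CloseOn s q) (hT' : ∀ q, q < t₂ → T'.CloseOn s q) :
    ∃ q, S.b < q ∧ q < t₂ ∧ ∃ m < S.a, T.CloseOn m q := by
  have hab := S.a_lt_b
  have hKs : S.traceIntegral S.b < S.traceIntegral s := by
    rw [← hr.two_mul_R S.b_mem le_rfl, ← hr.two_mul_R hs (hsa.trans hab).le]
    linarith
  -- On `[s, m]` closeness is already known, and at `m` the integrated trace lies strictly below its
  -- value at `s`. This leaves room for the extra term `4 * δ * t`.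
  obtain ⟨m, hsm, hma⟩ := exists_between hsa
  have hmD : (m : ℂ) ∈ S.Dt := hD m ⟨hsm.le, hma.trans (hab.trans hb)⟩
  have hKm : S.traceIntegral m < S.traceIntegral s :=
    hr.traceIntegral_strictAntiOn ⟨hs, hsa.le⟩ ⟨hmD, hma.le⟩ hsm
  obtain ⟨q0, ⟨hKq0, hq0b⟩, hq0t⟩ : ∃ q, (S.traceIntegral q < S.traceIntegral s ∧ S.b < q)
      ∧ q < t₂ := by
    have h1 : ∀ᶠ q in 𝓝[>] S.b, S.traceIntegral q < S.traceIntegral s :=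
      ((hr.hasDerivAt_traceIntegral S.b_mem).continuousAt.eventually_lt continuousAt_const
        hKs).filter_mono nhdsWithin_le_nhds
    exact ((h1.and self_mem_nhdsWithin).and
      (nhdsWithin_le_nhds (Iio_mem_nhds hb))).exists
  set c := S.traceIntegral s - max (S.traceIntegral m) (S.traceIntegral q0) with hc
  have hc0 : 0 < c := by
    have := max_lt hKm hKq0
    linarith
  have hq0s : 0 < q0 - s := by linarith
  set δ := c / (4 * (q0 - s)) with hδd
  have hδ : 0 < δ := by positivity
  -- Only after `δ` is fixed is the end point moved towards `b`, so that the discriminant stays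
  -- below `δ ^ 2 / 2` past `b`; shrinking `q` does not spoil the choice of `δ`.
  obtain ⟨e, he, hdisc⟩ := Metric.eventually_nhds_iff.1
    ((hr.continuousAt_realDisc S.b_mem).eventually_lt (continuousAt_const (y := δ ^ 2 / 2))
      ((hr.realDisc_nonpos S.b_mem le_rfl).trans_lt (by positivity)))
  set q := min q0 (S.b + e / 2) with hq
  have hqb : S.b < q := lt_min hq0b (by linarith)
  have hqq0 : q ≤ q0 := min_le_left _ _
  have hqt : q < t₂ := hqq0.trans_lt hq0t
  have hDq : ∀ t ∈ Set.Icc s q, (t : ℂ) ∈ S.Dt := fun t ht => hD t ⟨ht.1, ht.2.trans_lt hqt⟩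
  refine ⟨q, hqb, hqt, m, hma, ?_⟩
  have hsmall : ∀ᶠ ε in l, (0 : ℝ) < ε := hl self_mem_nhdsWithin
  have hsol : ∀ᶠ ε in l, ∀ t ∈ Set.Icc s q,
      HasDerivAt (T'.X ε) (ε⁻¹ • S.realField (t, T'.X ε t, ε)) t := by
    filter_upwards [hsmall, T'.isMaximal, hT' q hqt 1 one_pos] with ε hε hmax hI t ht
    exact (((S.isSolution_iff hε.ne').1 hmax.isSolution).2.2.2 t (hI t ht).1).2
  refine CloseOn.transfer hr hl hsm.le (by linarith) hDq hδ (fun t ht => ?_)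
    (K := fun t => S.traceIntegral t + 4 * δ * t) (K' := fun t => S.realTrace t + 4 * δ)
    (fun t ht => ?_) (fun t _ => le_rfl) (fun t ht => ?_) (hT m hma)
    (Z := T'.X) (Z' := fun ε t => ε⁻¹ • S.realField (t, T'.X ε t, ε))
    (fun η hη => (hT' q hqt η hη).mono fun ε hε t ht => (hε t ht).2) hsol (Or.inl ?_)
  · rcases le_or_gt t S.b with h | h
    · exact (hr.realDisc_nonpos (hDq t ht) h).trans (by positivity)
    · refine le_of_lt (hdisc ?_)
      have := ht.2.trans (min_le_right _ _)
      rw [Real.dist_eq, abs_of_pos (by linarith)]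
      linarith
  · simpa using! (hr.hasDerivAt_traceIntegral (hDq t ht)).add
      ((hasDerivAt_id t).const_mul (4 * δ))
  · have hst : s ≤ t := hsm.le.trans ht.1
    have htD := hDq t ⟨hst, ht.2⟩
    -- The integrated trace decreases up to `a` and increases afterwards, so its values on `[m, q]`
    -- are controlled by those at `m` and `q0`.
    have hKt : S.traceIntegral t ≤ max (S.traceIntegral m) (S.traceIntegral q0) := by
      rcases le_total t S.a with h | h
      · exact (hr.traceIntegral_strictAntiOn.antitoneOn ⟨hmD, hma.le⟩ ⟨htD, h⟩ ht.1).trans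
          (le_max_left _ _)
      · exact (hr.traceIntegral_monotoneOn ⟨htD, h⟩
          ⟨hD q0 ⟨by linarith, hq0t⟩, (hab.trans hq0b).le⟩ (ht.2.trans hqq0)).trans
          (le_max_right _ _)
    have hδc : 4 * δ * (q0 - s) = c := by rw [hδd]; field_simp
    have : 4 * δ * (t - s) ≤ c := by
      rw [← hδc]
      have := ht.2.trans hqq0
      gcongr
    linarith
  · filter_upwards [hsmall] with ε hε t _
    rw [smul_inv_smul₀ hε.ne', sub_self, norm_zero]

end Trajectory

end HFNSystem

/-! ### The theorem -/

theorem proposition8 (S : HFNSystem) (l : Filter ℝ) [l.NeBot] (hl : l ≤ 𝓝[>] (0 : ℝ))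
    (h : ∃ T : S.Trajectory l, (∃ t : ℝ, T.EarlyAt t) ∧ T.StopsAtFocusNode) :
    ∀ T : S.Trajectory l, T.StopsAtFocusNode := by
  obtain ⟨T, ⟨t₀, hearly⟩, hfails⟩ := h
  rintro T' t₁ ⟨ht₁a, hR₁, α₁, β₁, hα₁, hβ₁, hnear₁⟩ ⟨t₂, hb, hgoes⟩
  obtain ⟨ht₀a, hR₀, α₀, β₀, hα₀, hβ₀, hnear₀⟩ := id hearly
  have hab := S.a_lt_b
  have hr : S.HasRealSlow := HFNSystem.hasRealSlow_of_goesAlong (by linarith) hgoes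
  have ht₀D : (t₀ : ℂ) ∈ S.Dt := hnear₀.1 t₀ ⟨hα₀, hβ₀⟩
  have ht₁D : (t₁ : ℂ) ∈ S.Dt := hnear₁.1 t₁ ⟨hα₁, hβ₁⟩
  have hattr : ∀ p q, t₀ < p → q < S.a → T.CloseOn p q := by
    intro p q hp hq
    obtain ⟨u, hu, hu'⟩ := exists_between (lt_min hβ₀ (lt_min hp ht₀a))
    have huβ : u < β₀ := hu'.trans_le (min_le_left _ _)
    have hup : u < p := hu'.trans_le ((min_le_right _ _).trans (min_le_left _ _))
    have hua : u < S.a := hu'.trans_le ((min_le_right _ _).trans (min_le_right _ _))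
    have hclose : T.CloseOn u u := hnear₀.closeOn hr (hα₀.trans hu) huβ
    have hmax : T.CloseOn u (max u q) := hclose.attracted hr hl (le_max_left _ _)
      (hnear₀.1 u ⟨hα₀.trans hu, huβ⟩) (max_lt hua hq)
    exact hmax.mono hup.le (le_max_right _ _)
  set t := max t₀ t₁ with ht
  have hta : t < S.a := max_lt ht₀a ht₁a
  have htD : (t : ℂ) ∈ S.Dt := by
    rcases max_choice t₀ t₁ with h | h <;> rw [ht, h] <;> assumption
  have hRt : S.R S.b < S.R t := by
    rcases max_choice t₀ t₁ with h | h <;> rw [ht, h] <;> assumption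
  have hKt : S.traceIntegral S.b < S.traceIntegral t := by
    rw [← hr.two_mul_R S.b_mem le_rfl, ← hr.two_mul_R htD (hta.trans hab).le]
    linarith
  -- The comparison starts strictly after both `t₀` and `t₁`, since closeness is uniform only on
  -- compact subintervals; continuity preserves the strict inequality on the relief.
  obtain ⟨s, ⟨hKs, hts⟩, hsa⟩ : ∃ s, (S.traceIntegral S.b < S.traceIntegral s ∧ t < s)
      ∧ s < S.a := by
    have h1 : ∀ᶠ s in 𝓝[>] t, S.traceIntegral S.b < S.traceIntegral s :=
      (continuousAt_const.eventually_lt (hr.hasDerivAt_traceIntegral htD).continuousAt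
        hKt).filter_mono nhdsWithin_le_nhds
    exact ((h1.and self_mem_nhdsWithin).and
      (nhdsWithin_le_nhds (Iio_mem_nhds hta))).exists
  have ht₀s : t₀ < s := (le_max_left _ _).trans_lt hts
  have ht₁s : t₁ < s := (le_max_right _ _).trans_lt hts
  have hDs : ∀ u ∈ Set.Ico s t₂, (u : ℂ) ∈ S.Dt := fun u hu =>
    hgoes.1 u ⟨ht₁s.trans_le hu.1, hu.2⟩
  have hsD : (s : ℂ) ∈ S.Dt := hDs s ⟨le_rfl, by linarith⟩
  have hRs : S.R S.b < S.R s := by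
    rw [← hr.two_mul_R S.b_mem le_rfl, ← hr.two_mul_R hsD (hsa.trans hab).le] at hKs
    linarith
  obtain ⟨q, hbq, hqt, m, hma, hclose⟩ := HFNSystem.Trajectory.CloseOn.follow hr hl hsD hsa hRs
    hb hDs (fun q hq => hattr s q ht₀s hq) (fun q hq => hgoes.closeOn hr ht₁s hq)
  refine hfails t₀ hearly ⟨q, hbq, HFNSystem.Trajectory.CloseOn.goesAlong hr (fun u hu => ?_)
    fun p q' hp hq' η hη => ?_⟩
  · rcases lt_or_ge u s with h | h
    · exact S.ordConnected_realTrace.out ht₀D hsD ⟨hu.1.le, h.le⟩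
    · exact hDs u ⟨h, hu.2.trans hqt⟩
  -- Attraction covers the times up to `m < a`, the comparison with `T'` those from `m` to `q`.
  · filter_upwards [hattr p m hp hma η hη, hclose η hη] with ε h1 h2 u hu
    rcases le_total u m with h | h
    · exact h1 u ⟨hu.1, h⟩
    · exact h2 u ⟨h, hu.2.trans hq'.le⟩
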